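/- \textbf{(Positive recurrence for CTMC.)} Let $\Omega$ be a countable set with at least two elements, and let $\gamma_{j\to i}\ge 0$ ($j,i\in\Omega$) be transition rates with $\gamma_{i\to i}=0$ and bounded exit rates, that is $\sup_{j}\gamma_{j\to}<\infty$, where $\gamma_{j\to}:=\sum_{i}\gamma_{j\to i}$. Let $\Gamma$ be the generator, that is the bounded operator on $\ell^1(\Omega)$ with matrix entries $\Gamma^{(i,j)}=\gamma_{j\to i}$ for $i\ne j$ and $\Gamma^{(j,j)}=-\gamma_{j\to}$. Let $(X_t)_{t\ge 0}$ be a time-homogeneous continuous-time Markov chain on $\Omega$ with right-continuous paths and transition probabilities $\mathcal P(X_{s+t}=i\mid X_s=j)=(e^{t\Gamma})^{(i,j)}$, and assume that it is irreducible: every state can be reached from every state along transitions of positive rate. For a chain that starts in $X_0=\omega_0$, the return time is $$t_R:=\inf\{t>0 : X_t=\omega_0 \text{ and } X_\tau\neq\omega_0 \text{ for some } \tau\in(0,t)\}\in(0,\infty],\qquad \inf\emptyset:=\infty.$$ The state $\omega_0$ is \emph{positive recurrent} if $\mathcal P(t_R<\infty\mid X_0=\omega_0)=1$ and $E[t_R\mid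 X_0=\omega_0]<\infty$. A \emph{stationary solution} is a vector $P\in\ell^1(\Omega)$ with $P\ge 0$, $\|P\|_1=1$ and $\Gamma P=0$. The vector $T=T(\omega_0)$ of expected visiting times before return and the vector $N=N(\omega_0)$ of expected visiting numbers of the embedded discrete-time chain $(Y_k)_{k\ge 0}$ (the states of $X$ at time $0$ and at its successive jump times), both with values in $[0,\infty]$, are $$T_\omega:=E\Big[\int_0^{t_R}1_{\{X_t=\omega\}}\,dt\,\Big|\,X_0=\omega_0\Big],\qquad N_\omega:=E\Big[\sum_{0\le k<T_R}1_{\{Y_k=\omega\}}\,\Big|\,X_0=\omega_0\Big],\qquad T_R:=\inf\{k\ge 1 : Y_k=Y_0\},$$ and $\|T\|_1:=\sum_\omega T_\omega$. Then: \begin{itemize} \item The following are equivalent: (i) every state is positive recurrent; (ii) some state is positive recurrent; (iii) a stationary solution exists. \item If these conditions hold, then for every $\omega_0\in\Omega$ one has $0<\|T\|_1<\infty$, and $T/\|T\|_1$ is the unique stationary solution. \item For all $\omega_0,\omega\in\Omega$ one has $T_\omega=N_\omega/\gamma_{\omega\to}$ (whether or not the conditions above hold). \end{itemize} -/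

import Mathlib

open scoped NNReal ENNReal Topology
open MeasureTheory

namespace CTMC

/-- The Banach space `ℓ¹(S)` of absolutely summable real vectors indexed by the states. -/
abbrev L1 (S : Type*) : Type _ := lp (fun _ : S => ℝ) 1

/-- The transition rates of a continuous-time Markov chain: `rate j i` is the rate of the
transition `j → i`. There are no self-loops, and the exit rates are bounded, which means that the
generator is a bounded operator on `ℓ¹(S)`. -/
structure Network (S : Type*) where
  rate : S → S → ℝ≥0
  rate_self : ∀ i, rate i i = 0
  bounded : ∃ C : ℝ≥0, ∀ j, ∑' i, (rate j i : ℝ≥0∞) ≤ C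

namespace Network

variable {S : Type*} (γ : Network S)

theorem summable_rate (j : S) : Summable (γ.rate j) := by
  obtain ⟨C, hC⟩ := γ.bounded
  exact ENNReal.tsum_coe_ne_top_iff_summable.1
    (ne_top_of_le_ne_top ENNReal.coe_ne_top (hC j))

/-- The total rate `∑ i, rate j i` at which the chain leaves the state `j`. -/
noncomputable def exitRate (j : S) : ℝ≥0 := ∑' i, γ.rate j i

open scoped Classical in
/-- The entry of the generator matrix in row `i` and column `j`. Columns sum to zero. -/
noncomputable def entry (i j : S) : ℝ :=
  if i = j then -(γ.exitRate j : ℝ) else (γ.rate j i : ℝ)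

/-- The network is irreducible (strongly connected): every state can be reached from every state
along transitions of positive rate. -/
def IsIrreducible : Prop :=
  ∀ i j : S, Relation.ReflTransGen (fun a b => 0 < γ.rate a b) i j

theorem exists_exitRate_le : ∃ C : ℝ≥0, ∀ j, γ.exitRate j ≤ C := by
  obtain ⟨C, hC⟩ := γ.bounded
  refine ⟨C, fun j => ?_⟩
  have h := hC j
  rw [← ENNReal.coe_tsum (γ.summable_rate j)] at h
  exact_mod_cast h

open scoped Classical in
theorem abs_entry_le (i j : S) :
    |γ.entry i j| ≤ (γ.rate j i : ℝ) + (Pi.single j (γ.exitRate j : ℝ) : S → ℝ) i := by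
  unfold entry
  by_cases h : i = j
  · subst h; simp
  · simp [h]

open scoped Classical in
theorem summable_bound (j : S) : Summable fun i =>
    (γ.rate j i : ℝ) + (Pi.single j (γ.exitRate j : ℝ) : S → ℝ) i :=
  (NNReal.summable_coe.2 (γ.summable_rate j)).add (hasSum_pi_single j _).summable

theorem summable_abs_entry (j : S) : Summable fun i => |γ.entry i j| :=
  (γ.summable_bound j).of_nonneg_of_le (fun _ => abs_nonneg _) (fun i => γ.abs_entry_le i j)

theorem tsum_abs_entry_le (j : S) : ∑' i, |γ.entry i j| ≤ 2 * γ.exitRate j := by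
  classical
  refine ((γ.summable_abs_entry j).tsum_le_tsum (fun i => γ.abs_entry_le i j)
    (γ.summable_bound j)).trans (le_of_eq ?_)
  rw [(NNReal.summable_coe.2 (γ.summable_rate j)).tsum_add (hasSum_pi_single j _).summable,
    (hasSum_pi_single j _).tsum_eq, ← NNReal.coe_tsum]
  simp only [exitRate]
  ring

theorem L1.summable_abs (x : L1 S) : Summable fun j => |x j| := by
  simpa using (lp.memℓp x).summable (by simp)

theorem L1.norm_eq (x : L1 S) : ‖x‖ = ∑' j, |x j| := by
  simpa using lp.norm_eq_tsum_rpow (p := 1) (by simp) x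

theorem summable_abs_prod (x : L1 S) :
    Summable fun p : S × S => |γ.entry p.2 p.1 * x p.1| := by
  obtain ⟨C, hC⟩ := γ.exists_exitRate_le
  refine (summable_prod_of_nonneg (fun _ => abs_nonneg _)).2 ⟨fun j => ?_, ?_⟩
  · simpa only [abs_mul] using (γ.summable_abs_entry j).mul_right |x j|
  · refine ((L1.summable_abs x).mul_left (2 * (C : ℝ))).of_nonneg_of_le
      (fun j => tsum_nonneg fun _ => abs_nonneg _) (fun j => ?_)
    simp only [abs_mul, tsum_mul_right]
    refine mul_le_mul_of_nonneg_right ((γ.tsum_abs_entry_le j).trans ?_) (abs_nonneg _)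
    exact mul_le_mul_of_nonneg_left (by exact_mod_cast hC j) (by norm_num)

theorem summable_row (x : L1 S) (i : S) : Summable fun j => γ.entry i j * x j :=
  Summable.of_norm <| by
    simpa using (γ.summable_abs_prod x).prod_symm.prod_factor i

theorem summable_abs_mulVec (x : L1 S) : Summable fun i => |∑' j, γ.entry i j * x j| := by
  refine (γ.summable_abs_prod x).prod_symm.prod.of_nonneg_of_le (fun _ => abs_nonneg _)
    (fun i => ?_)
  simpa using norm_tsum_le_tsum_norm (f := fun j => γ.entry i j * x j)
    (by simpa using (γ.summable_abs_prod x).prod_symm.prod_factor i)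

theorem tsum_abs_mulVec_le {C : ℝ≥0} (hC : ∀ j, γ.exitRate j ≤ C) (x : L1 S) :
    ∑' i, |∑' j, γ.entry i j * x j| ≤ 2 * C * ‖x‖ := by
  have hs := γ.summable_abs_prod x
  calc ∑' i, |∑' j, γ.entry i j * x j|
      ≤ ∑' i, ∑' j, |γ.entry i j * x j| := by
        refine (γ.summable_abs_mulVec x).tsum_le_tsum (fun i => ?_) hs.prod_symm.prod
        simpa using norm_tsum_le_tsum_norm (f := fun j => γ.entry i j * x j)
          (by simpa using hs.prod_symm.prod_factor i)
    _ = ∑' j, ∑' i, |γ.entry i j * x j| :=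
        Summable.tsum_comm (f := fun j i => |γ.entry i j * x j|) hs
    _ ≤ ∑' j, 2 * C * |x j| := by
        refine hs.prod.tsum_le_tsum (fun j => ?_) ((L1.summable_abs x).mul_left _)
        simp only [abs_mul, tsum_mul_right]
        refine mul_le_mul_of_nonneg_right ((γ.tsum_abs_entry_le j).trans ?_) (abs_nonneg _)
        exact mul_le_mul_of_nonneg_left (by exact_mod_cast hC j) (by norm_num)
    _ = 2 * C * ‖x‖ := by rw [tsum_mul_left, L1.norm_eq]

/-- The matrix-vector product of the generator matrix with `x`, as a vector in `ℓ¹(S)`. -/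
noncomputable def mulVec (x : L1 S) : L1 S :=
  ⟨fun i => ∑' j, γ.entry i j * x j, memℓp_gen (by simpa using γ.summable_abs_mulVec x)⟩

/-- The generator as a bounded linear operator on `ℓ¹(S)`: `(generator x) i = ∑ j, entry i j * x j`.
-/
noncomputable def generator : L1 S →L[ℝ] L1 S :=
  LinearMap.mkContinuousOfExistsBound
    { toFun := γ.mulVec
      map_add' := fun x y => by
        ext i
        simp only [mulVec, lp.coeFn_add, Pi.add_apply, mul_add]
        exact (γ.summable_row x i).tsum_add (γ.summable_row y i)
      map_smul' := fun c x => by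
        ext i
        simp only [mulVec, lp.coeFn_smul, Pi.smul_apply, smul_eq_mul, RingHom.id_apply,
          ← tsum_mul_left]
        exact tsum_congr fun j => by ring }
    (by
      obtain ⟨C, hC⟩ := γ.exists_exitRate_le
      refine ⟨2 * C, fun x => ?_⟩
      rw [L1.norm_eq]
      exact γ.tsum_abs_mulVec_le hC x)

theorem generator_apply (x : L1 S) (i : S) :
    γ.generator x i = ∑' j, γ.entry i j * x j := rfl

open scoped Classical in
/-- The transition probability from `j` to `i` in time `t`: the entry in row `i` and column `j` of
the solution operator `exp (t • generator)` of the master equation. -/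
noncomputable def transition (t : ℝ≥0) (i j : S) : ℝ :=
  (NormedSpace.exp ((t : ℝ) • γ.generator) (lp.single 1 j (1 : ℝ)) : L1 S) i

/-- A stationary solution of the master equation: a probability vector in the kernel of the
generator. -/
def IsStationary (P : L1 S) : Prop :=
  (∀ i, 0 ≤ P i) ∧ ‖P‖ = 1 ∧ γ.generator P = 0

end Network

/-- `X` is a (time-homogeneous) continuous-time Markov chain on the discrete state space `S` with
rates `γ`, where `ℙ j` is the law under which the chain starts in the state `j`.

The field `markov` is the Markov property with transition probabilities `γ.transition`, with the
conditional probability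
`P(X (t n + u) = i | X (t n) = s n, …, X (t 0) = s 0) = γ.transition u i (s n)`
multiplied out, so that no event of probability zero has to be excluded. -/
structure IsMarkovChain {S Ω : Type*} [MeasurableSpace Ω] (γ : Network S)
    (ℙ : S → Measure Ω) (X : ℝ≥0 → Ω → S) : Prop where
  isProbabilityMeasure : ∀ j, IsProbabilityMeasure (ℙ j)
  measurableSet : ∀ t i, MeasurableSet {ω | X t ω = i}
  rightContinuous : ∀ ω t, ∀ᶠ s in 𝓝[>] t, X s ω = X t ω
  start : ∀ j, ℙ j {ω | X 0 ω = j} = 1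
  markov : ∀ (j : S) (n : ℕ) (t : Fin (n + 1) → ℝ≥0), Monotone t →
    ∀ (s : Fin (n + 1) → S) (u : ℝ≥0) (i : S),
      ℙ j {ω | (∀ k, X (t k) ω = s k) ∧ X (t (Fin.last n) + u) ω = i} =
        ℙ j {ω | ∀ k, X (t k) ω = s k} * ENNReal.ofReal (γ.transition u i (s (Fin.last n)))

section Paths

variable {S : Type*}

/-- The return time of a continuous-time path: the first time `t > 0` at which the path is in its
initial state again, after it has left it (`∞` if there is none). -/
noncomputable def returnTime (x : ℝ≥0 → S) : ℝ≥0∞ :=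
  ⨅ t ∈ {t : ℝ≥0 | x t = x 0 ∧ ∃ τ, 0 < τ ∧ τ < t ∧ x τ ≠ x 0}, (t : ℝ≥0∞)

/-- The jump times of a continuous-time path: `0`, followed by the successive times at which the
path leaves the state that it is in (`∞` if it does not). -/
noncomputable def jumpTime (x : ℝ≥0 → S) : ℕ → ℝ≥0∞
  | 0 => 0
  | k + 1 => ⨅ t ∈ {t : ℝ≥0 | jumpTime x k < t ∧ x t ≠ x (jumpTime x k).toNNReal}, (t : ℝ≥0∞)

/-- The embedded discrete-time path: the states of the path at its jump times. (For an irreducible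
chain with at least two states, all jump times are almost surely finite.) -/
noncomputable def embedded (x : ℝ≥0 → S) (k : ℕ) : S := x (jumpTime x k).toNNReal

/-- The return time `T_R = inf {k ≥ 1 | y k = y 0}` of a discrete-time path (`∞` if there is no
such `k`). -/
noncomputable def discreteReturnTime (y : ℕ → S) : ℕ∞ :=
  ⨅ k ∈ {k : ℕ | 1 ≤ k ∧ y k = y 0}, (k : ℕ∞)

end Paths

section Expectations

variable {S Ω : Type*} [MeasurableSpace Ω] (ℙ : S → Measure Ω) (X : ℝ≥0 → Ω → S)

/-- The state `j` is positive recurrent: a chain that starts in `j` almost surely returns to `j`,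
and the expected return time is finite. -/
def IsPositiveRecurrent (j : S) : Prop :=
  ℙ j {ω | returnTime (fun t => X t ω) < ∞} = 1 ∧
    ∫⁻ ω, returnTime (fun t => X t ω) ∂(ℙ j) < ∞

open scoped Classical in
/-- The expected time `T_i = E[∫₀^{t_R} 1_{X_t = i} dt]` that a chain starting in `j` spends in `i`
before it returns to `j`. -/
noncomputable def visitingTime (j i : S) : ℝ≥0∞ :=
  ∫⁻ ω, (∫⁻ t : ℝ in {t : ℝ | 0 ≤ t ∧ ENNReal.ofReal t < returnTime (fun s => X s ω)},
    if X t.toNNReal ω = i then 1 else 0) ∂(ℙ j)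

/-- The norm `‖T‖₁ = ∑ i, T_i` of the vector of expected visiting times. -/
noncomputable def visitingTimeNorm (j : S) : ℝ≥0∞ := ∑' i, visitingTime ℙ X j i

open scoped Classical in
/-- The expected number `N_i = E[∑_{0 ≤ k < T_R} 1_{Y_k = i}]` of visits to `i` of the embedded
discrete-time chain `Y`, starting in `j`, before it returns to `j`. -/
noncomputable def visitingNumber (j i : S) : ℝ≥0∞ :=
  ∫⁻ ω, (∑' k : ℕ,
    if (k : ℕ∞) < discreteReturnTime (embedded fun t => X t ω) ∧
      embedded (fun t => X t ω) k = i then 1 else 0) ∂(ℙ j)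

end Expectations

end CTMC

/-!
The proof reduces the chain `X` to its embedded chain `Y` with the jump times `J k`, and then argues
with invariant measures.

**The law of the jumps.** Only the finite-dimensional distributions of `X` are given, so the path is
sampled on a grid of mesh `h`. The sampled chain stays in a state for a geometric time, and the
generating function of the time at which it has first visited a given list of states is therefore
explicit (`toReal_firstHistoryGen_cons_cons`). A right-continuous path makes only one jump at a time
on a sufficiently fine grid (`firstHistory_iff`), so the generating functions converge to
`E[exp (-c * J k); Y 0, …, Y k given]` as `h` tends to `0`, while the derivative of the transition
probabilities at `0` is the generator. The result is the recursion `lintegral_discountedVisit_succ'`: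
a further jump from `a` to `b` contributes the factor `γ.rate a b / (c + γ.exitRate a)`, whatever the
path was before.

This recursion contains all that is needed. For `c = 0` it is the Markov property of `Y` and shows
that all jump times are finite. For `c = 1` it shows that `E[exp (-J k)]` decays geometrically,
because the exit rates are bounded, so there is no explosion. In the limit `c → 0`, the difference
quotient `(exp (-c * J k) - exp (-c * J (k + 1))) / c` increases to the holding time, the mean of
which is therefore `1 / γ.exitRate a`, independently of the past.

**Visiting times.** Almost every path is thus a sequence of jump intervals that cover the time axis,
and `X` returns at the `T_R`-th jump time. Integration over the jump intervals gives `T = N / γ` and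
`E[t_R] = ‖T‖₁`, so that `j` is positive recurrent if and only if `‖T‖₁ < ∞`.

**Invariant measures.** The Markov property of `Y` gives the balance `T i * γ i = ∑ a, T a * γ a i`
in every `i ≠ j`, and `T j * γ j = 1`. If `‖T‖₁` is finite, summation over all states gives the
balance in `j` as well, and `T / ‖T‖₁` is stationary. Conversely, if `P` is stationary, induction
over the time of the embedded chain shows `T ≤ P / (P j * γ j)`, hence `‖T‖₁ < ∞` for every `j`. The
difference `P / (P j * γ j) - T` is an invariant measure that vanishes in `j`, so it vanishes
everywhere by irreducibility, which is the uniqueness.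
-/

namespace CTMC

open Filter

/-! ### The master equation at time zero -/

namespace Network

variable {S : Type*} (γ : Network S)

open scoped Classical in
theorem generator_single (i j : S) : γ.generator (lp.single 1 j (1 : ℝ)) i = γ.entry i j := by
  rw [generator_apply, tsum_eq_single j]
  · simp
  · intro b hb
    simp [lp.single_apply, hb]

open scoped Classical in
/-- The master equation at time `0`: the derivative of the transition probabilities is the
generator matrix. -/
theorem tendsto_transition_slope (i j : S) {h : ℕ → ℝ≥0} (h0 : ∀ n, 0 < h n)
    (hlim : Tendsto h atTop (𝓝 0)) :
    Tendsto (fun n => (γ.transition (h n) i j - if i = j then 1 else 0) / (h n : ℝ)) atTop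
      (𝓝 (γ.entry i j)) := by
  have h1 := hasDerivAt_exp_smul_const (𝕂 := ℝ) γ.generator (0 : ℝ)
  have h2 : HasDerivAt (fun t : ℝ =>
      (NormedSpace.exp (t • γ.generator) (lp.single 1 j (1 : ℝ)) : L1 S))
      (γ.generator (lp.single 1 j (1 : ℝ))) 0 := by
    have := h1.clm_apply (hasDerivAt_const (0 : ℝ) (lp.single 1 j (1 : ℝ) : L1 S))
    simpa using this
  have h3 := ((lp.evalCLM ℝ (fun _ : S => ℝ) 1 i).hasFDerivAt (x := _)).comp_hasDerivAt (0 : ℝ) h2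
  have h4 := h3.tendsto_slope_zero_right
  have h5 : Tendsto (fun n => (h n : ℝ)) atTop (𝓝[>] 0) := by
    refine tendsto_nhdsWithin_iff.2 ⟨(NNReal.continuous_coe.tendsto 0).comp hlim, ?_⟩
    exact Eventually.of_forall fun n => by simpa using h0 n
  have h6 := h4.comp h5
  have e : γ.entry i j = (lp.evalCLM ℝ (fun _ : S => ℝ) 1 i)
      (γ.generator (lp.single 1 j (1 : ℝ))) := by
    rw [← generator_single]; rfl
  rw [e]
  refine h6.congr fun n => ?_
  simp only [Function.comp, zero_add, zero_smul, NormedSpace.exp_zero, smul_eq_mul, transition]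
  rw [div_eq_inv_mul]
  congr 2
  change ((lp.single 1 j (1 : ℝ) : L1 S) i) = _
  simp [lp.single_apply, Pi.single_apply]

end Network

/-! ### Histories of discrete-time chains -/

section History

variable {S : Type*}

open scoped Classical in
/-- The states that the discrete path `y` has visited up to time `m`, the latest first, where
consecutive repetitions are recorded only once. -/
noncomputable def history (y : ℕ → S) : ℕ → List S
  | 0 => [y 0]
  | m + 1 => if y (m + 1) = y m then history y m else y (m + 1) :: history y m

/-- The discrete path `y` has the history `l` at time `m`, and not before. -/
def FirstHistory (y : ℕ → S) (l : List S) (m : ℕ) : Prop :=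
  history y m = l ∧ ∀ m' < m, history y m' ≠ l

theorem history_succ_of_eq {y : ℕ → S} {m : ℕ} (h : y (m + 1) = y m) :
    history y (m + 1) = history y m := if_pos h

theorem history_succ_of_ne {y : ℕ → S} {m : ℕ} (h : y (m + 1) ≠ y m) :
    history y (m + 1) = y (m + 1) :: history y m := if_neg h

theorem head?_history (y : ℕ → S) (m : ℕ) : (history y m).head? = some (y m) := by
  induction m with
  | zero => rfl
  | succ m ih =>
    by_cases h : y (m + 1) = y m
    · rw [history_succ_of_eq h, ih, h]
    · rw [history_succ_of_ne h]; rfl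

theorem eq_of_history_eq_cons {y : ℕ → S} {m : ℕ} {b : S} {l : List S}
    (h : history y m = b :: l) : y m = b := by
  simpa [h] using (head?_history y m).symm

theorem history_congr {y y' : ℕ → S} {m : ℕ} (h : ∀ k ≤ m, y k = y' k) :
    history y m = history y' m := by
  induction m with
  | zero => simp [history, h 0 le_rfl]
  | succ m ih =>
    simp only [history, ih fun k hk => h k (hk.trans (Nat.le_succ m))]
    rw [h (m + 1) le_rfl, h m (Nat.le_succ m)]

theorem length_history_mono (y : ℕ → S) : Monotone fun m => (history y m).length := by
  refine monotone_nat_of_le_succ fun m => ?_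
  by_cases h : y (m + 1) = y m
  · rw [history_succ_of_eq h]
  · rw [history_succ_of_ne h]; simp

theorem history_succ_of_length_le {y : ℕ → S} {m : ℕ}
    (h : (history y (m + 1)).length ≤ (history y m).length) :
    y (m + 1) = y m ∧ history y (m + 1) = history y m := by
  by_cases h' : y (m + 1) = y m
  · exact ⟨h', history_succ_of_eq h'⟩
  · rw [history_succ_of_ne h'] at h; simp at h

theorem history_succ_eq_cons_iff {y : ℕ → S} {m : ℕ} {b : S} {l : List S} :
    history y (m + 1) = b :: l ↔
      FirstHistory y (b :: l) (m + 1) ∨ (history y m = b :: l ∧ y (m + 1) = b) := by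
  constructor
  · intro h
    by_cases hf : FirstHistory y (b :: l) (m + 1)
    · exact Or.inl hf
    · right
      have : ∃ m' < m + 1, history y m' = b :: l := by
        by_contra! hc
        exact hf ⟨h, hc⟩
      obtain ⟨m', hm', h'⟩ := this
      have hl : (history y (m + 1)).length ≤ (history y m).length := by
        rw [h, ← h']
        exact length_history_mono y (Nat.lt_succ_iff.1 hm')
      exact ⟨(history_succ_of_length_le hl).2 ▸ h, eq_of_history_eq_cons h⟩
  · rintro (h | ⟨h, h'⟩)
    · exact h.1
    · rw [history_succ_of_eq (h'.trans (eq_of_history_eq_cons h).symm), h]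

theorem firstHistory_succ_cons_cons_iff {y : ℕ → S} {m : ℕ} {a b : S} (hab : a ≠ b)
    {l : List S} :
    FirstHistory y (b :: a :: l) (m + 1) ↔ history y m = a :: l ∧ y (m + 1) = b := by
  constructor
  · rintro ⟨h, h'⟩
    by_cases e : y (m + 1) = y m
    · rw [history_succ_of_eq e] at h
      exact absurd h (h' m (Nat.lt_succ_self m))
    · rw [history_succ_of_ne e] at h
      injection h with h1 h2
      exact ⟨h2, h1⟩
  · rintro ⟨h, h'⟩
    have e : y (m + 1) ≠ y m := by
      rw [h', eq_of_history_eq_cons h]; exact hab.symm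
    refine ⟨by rw [history_succ_of_ne e, h, h'], fun m' hm' hc => ?_⟩
    have := length_history_mono y (Nat.lt_succ_iff.1 hm')
    simp only [hc, h, List.length_cons] at this
    omega

theorem not_firstHistory_zero_cons_cons (y : ℕ → S) (a b : S) (l : List S) :
    ¬ FirstHistory y (b :: a :: l) 0 := by
  rintro ⟨h, -⟩
  simp [history] at h

theorem FirstHistory.unique {y : ℕ → S} {l : List S} {m m' : ℕ} (h : FirstHistory y l m)
    (h' : FirstHistory y l m') : m = m' := by
  rcases lt_trichotomy m m' with hlt | heq | hgt
  · exact absurd h.1 (h'.2 m hlt)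
  · exact heq
  · exact absurd h'.1 (h.2 m' hgt)

end History

section Discrete

variable {S Ω : Type*} {y : ℕ → Ω → S}

/-- An event that concerns the history is a union of cylinders, which is countable if the state space
is. -/
theorem history_eq_iUnion (n : ℕ) (l : List S) (p : Ω → Prop) :
    {ω | history (fun m => y m ω) n = l ∧ p ω} =
      ⋃ s : {s : Fin (n + 1) → S // history (fun k => s (Fin.ofNat (n + 1) k)) n = l},
        {ω | (∀ k : Fin (n + 1), y k ω = s.1 k) ∧ p ω} := by
  ext ω
  simp only [Set.mem_ofPred_eq, Set.mem_iUnion, Subtype.exists, exists_prop]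
  constructor
  · rintro ⟨h, hp⟩
    refine ⟨fun k => y k ω, ?_, fun _ => rfl, hp⟩
    rw [← h]
    refine history_congr fun k hk => ?_
    simp [Nat.mod_eq_of_lt (Nat.lt_succ_of_le hk)]
  · rintro ⟨s, hs, h, hp⟩
    refine ⟨?_, hp⟩
    rw [← hs]
    refine history_congr fun k hk => ?_
    rw [← h]
    simp [Nat.mod_eq_of_lt (Nat.lt_succ_of_le hk)]

variable [MeasurableSpace Ω] {μ : Measure Ω} {Q : S → S → ℝ≥0∞}

theorem measurableSet_cylinder (hy : ∀ n i, MeasurableSet {ω | y n ω = i}) (n : ℕ)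
    (s : Fin (n + 1) → S) : MeasurableSet {ω | ∀ k : Fin (n + 1), y k ω = s k} := by
  simp only [Set.ofPred_forall]
  exact MeasurableSet.iInter fun k => hy k (s k)

/-- The Markov property of a discrete-time process, multiplied out as in `IsMarkovChain.markov`. -/
def HasTransition (μ : Measure Ω) (y : ℕ → Ω → S) (Q : S → S → ℝ≥0∞) : Prop :=
  ∀ (n : ℕ) (s : Fin (n + 1) → S) (i : S),
    μ {ω | (∀ k : Fin (n + 1), y k ω = s k) ∧ y (n + 1) ω = i} =
      μ {ω | ∀ k : Fin (n + 1), y k ω = s k} * Q (s (Fin.last n)) i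

/-- The generating function of the probabilities that the history is `l` at time `m`. -/
noncomputable def historyGen (μ : Measure Ω) (y : ℕ → Ω → S) (r : ℝ≥0∞) (l : List S) : ℝ≥0∞ :=
  ∑' m, r ^ m * μ {ω | history (fun m => y m ω) m = l}

/-- The generating function of the probabilities that the history is `l` for the first time at
time `m`. -/
noncomputable def firstHistoryGen (μ : Measure Ω) (y : ℕ → Ω → S) (r : ℝ≥0∞) (l : List S) :
    ℝ≥0∞ :=
  ∑' m, r ^ m * μ {ω | FirstHistory (fun m => y m ω) l m}

theorem historyGen_ne_top [IsProbabilityMeasure μ] {r : ℝ≥0∞} (hr : r < 1) (l : List S) :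
    historyGen μ y r l ≠ ∞ := by
  refine ne_top_of_le_ne_top (b := ∑' m, r ^ m) ?_ ?_
  · rw [ENNReal.tsum_geometric]
    simpa [ENNReal.inv_eq_top] using (tsub_pos_of_lt hr).ne'
  · exact ENNReal.tsum_le_tsum fun m => mul_le_of_le_one_right' prob_le_one

variable [Countable S]

theorem measurableSet_history (hy : ∀ n i, MeasurableSet {ω | y n ω = i}) (n : ℕ) (l : List S) :
    MeasurableSet {ω | history (fun m => y m ω) n = l} := by
  have := history_eq_iUnion (y := y) n l (fun _ => True)
  simp only [and_true] at this
  rw [this]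
  exact MeasurableSet.iUnion fun s => measurableSet_cylinder hy n s.1

theorem measurableSet_firstHistory (hy : ∀ n i, MeasurableSet {ω | y n ω = i}) (n : ℕ)
    (l : List S) : MeasurableSet {ω | FirstHistory (fun m => y m ω) l n} := by
  simp only [FirstHistory, Set.ofPred_and, Set.ofPred_forall]
  exact (measurableSet_history hy n l).inter <| MeasurableSet.iInter fun m =>
    MeasurableSet.iInter fun _ => (measurableSet_history hy m l).compl

/-- The Markov property, with the event that the history is `b :: l`. -/
theorem measure_history_and_next (hy : ∀ n i, MeasurableSet {ω | y n ω = i})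
    (hQ : HasTransition μ y Q) (n : ℕ) (b : S) (l : List S) (i : S) :
    μ {ω | history (fun m => y m ω) n = b :: l ∧ y (n + 1) ω = i} =
      μ {ω | history (fun m => y m ω) n = b :: l} * Q b i := by
  have e1 := history_eq_iUnion (y := y) n (b :: l) (fun ω => y (n + 1) ω = i)
  have e2 := history_eq_iUnion (y := y) n (b :: l) (fun _ => True)
  simp only [and_true] at e2
  have hd : Pairwise (Function.onFun Disjoint
      fun s : {s : Fin (n + 1) → S // history (fun k => s (Fin.ofNat (n + 1) k)) n = b :: l} =>
        {ω | ∀ k : Fin (n + 1), y k ω = s.1 k}) := by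
    intro s s' hs
    refine Set.disjoint_left.2 fun ω h h' => hs ?_
    ext k
    rw [← h k, ← h' k]
  rw [e1, e2, measure_iUnion (hd.mono fun s s' h => h.mono (fun ω h => h.1) (fun ω h => h.1))
    fun s => ?_, measure_iUnion hd fun s => measurableSet_cylinder hy n s.1,
    ← ENNReal.tsum_mul_right]
  · refine tsum_congr fun s => ?_
    have := eq_of_history_eq_cons s.2
    rw [hQ n s.1 i]
    congr 2
    have e : Fin.ofNat (n + 1) n = Fin.last n := by ext; simp
    rw [← e, this]
  · exact (measurableSet_cylinder hy n s.1).inter (hy (n + 1) i)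

/-- The chain either has just reached the history `b :: l`, or had it before and has stayed in `b`. -/
theorem historyGen_cons (hy : ∀ n i, MeasurableSet {ω | y n ω = i})
    (hQ : HasTransition μ y Q) (r : ℝ≥0∞) (b : S) (l : List S) :
    historyGen μ y r (b :: l) =
      firstHistoryGen μ y r (b :: l) + r * Q b b * historyGen μ y r (b :: l) := by
  have h (m : ℕ) : μ {ω | history (fun m => y m ω) (m + 1) = b :: l} =
      μ {ω | FirstHistory (fun m => y m ω) (b :: l) (m + 1)} +
        μ {ω | history (fun m => y m ω) m = b :: l} * Q b b := by
    rw [← measure_history_and_next hy hQ, ← measure_union]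
    · congr 1
      ext ω
      exact history_succ_eq_cons_iff
    · exact Set.disjoint_left.2 fun ω h h' => h.2 m (Nat.lt_succ_self m) h'.1
    · exact (measurableSet_history hy m _).inter (hy _ _)
  have h0 : {ω | history (fun m => y m ω) 0 = b :: l} =
      {ω | FirstHistory (fun m => y m ω) (b :: l) 0} := by
    ext ω; simp [FirstHistory]
  have e := tsum_eq_zero_add' (f := fun m => r ^ m * μ {ω | history (fun m => y m ω) m = b :: l})
    ENNReal.summable
  rw [← historyGen] at e
  conv_lhs => rw [e]
  rw [firstHistoryGen, tsum_eq_zero_add' (f := fun m =>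
    r ^ m * μ {ω | FirstHistory (fun m => y m ω) (b :: l) m}) ENNReal.summable, h0,
    add_assoc]
  congr 1
  simp only [h, mul_add]
  rw [ENNReal.tsum_add, historyGen, ← ENNReal.tsum_mul_left]
  congr 1
  refine tsum_congr fun m => ?_
  rw [pow_succ]; ring

theorem firstHistoryGen_cons_cons (hy : ∀ n i, MeasurableSet {ω | y n ω = i})
    (hQ : HasTransition μ y Q) (r : ℝ≥0∞) {a b : S} (hab : a ≠ b) (l : List S) :
    firstHistoryGen μ y r (b :: a :: l) = r * Q a b * historyGen μ y r (a :: l) := by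
  rw [firstHistoryGen, tsum_eq_zero_add' ENNReal.summable, historyGen, ← ENNReal.tsum_mul_left]
  simp only [not_firstHistory_zero_cons_cons, firstHistory_succ_cons_cons_iff hab,
    measure_history_and_next hy hQ]
  simp only [Set.ofPred_false, measure_empty, mul_zero, zero_add]
  refine tsum_congr fun m => ?_
  rw [pow_succ]; ring

/-- The history changes from `a :: l` to `b :: a :: l` after a geometric time in `a`. -/
theorem toReal_firstHistoryGen_cons_cons [IsProbabilityMeasure μ]
    (hy : ∀ n i, MeasurableSet {ω | y n ω = i}) (hQ : HasTransition μ y Q) {r : ℝ≥0∞}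
    (hr : r < 1) {a b : S} (hab : a ≠ b) (l : List S) (ha : Q a a ≤ 1) :
    (firstHistoryGen μ y r (b :: a :: l)).toReal =
      (firstHistoryGen μ y r (a :: l)).toReal *
        (r.toReal * (Q a b).toReal / (1 - r.toReal * (Q a a).toReal)) := by
  have hU := historyGen_ne_top (μ := μ) (y := y) hr (a :: l)
  have hr' : r ≠ ∞ := hr.ne_top
  have h1 := congrArg ENNReal.toReal (historyGen_cons hy hQ r a l)
  have hW : firstHistoryGen μ y r (a :: l) ≠ ∞ :=
    ne_top_of_le_ne_top hU (by rw [historyGen_cons hy hQ]; exact le_self_add)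
  have hQa : Q a a ≠ ∞ := ne_top_of_le_ne_top ENNReal.one_ne_top ha
  rw [ENNReal.toReal_add hW (ENNReal.mul_ne_top (ENNReal.mul_ne_top hr' hQa) hU),
    ENNReal.toReal_mul, ENNReal.toReal_mul] at h1
  rw [firstHistoryGen_cons_cons hy hQ r hab, ENNReal.toReal_mul, ENNReal.toReal_mul]
  have hr1 : r.toReal < 1 := by
    simpa using (ENNReal.toReal_lt_toReal hr' ENNReal.one_ne_top).2 hr
  have hq1 : (Q a a).toReal ≤ 1 := by
    simpa using ENNReal.toReal_mono ENNReal.one_ne_top ha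
  have : 1 - r.toReal * (Q a a).toReal ≠ 0 := by
    have : r.toReal * (Q a a).toReal ≤ r.toReal * 1 :=
      mul_le_mul_of_nonneg_left hq1 ENNReal.toReal_nonneg
    intro h; linarith
  have h2 : (firstHistoryGen μ y r (a :: l)).toReal =
      (historyGen μ y r (a :: l)).toReal * (1 - r.toReal * (Q a a).toReal) := by
    linear_combination -h1
  rw [h2]
  field_simp

end Discrete

/-! ### Sampling a right-continuous path on a fine grid -/

section PathLemmas

variable {S : Type*} {x : ℝ≥0 → S}

/-- Right-continuity of a path in a discrete state space. -/
def IsRightContinuous (x : ℝ≥0 → S) : Prop := ∀ t, ∀ᶠ s in 𝓝[>] t, x s = x t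

theorem IsRightContinuous.exists_gt (hx : IsRightContinuous x) (t : ℝ≥0) :
    ∃ u, t < u ∧ ∀ s, t ≤ s → s < u → x s = x t := by
  obtain ⟨u, hu, h⟩ := (mem_nhdsGT_iff_exists_Ioo_subset' (lt_add_one t)).1 (hx t)
  refine ⟨u, hu, fun s hs hs' => ?_⟩
  rcases hs.eq_or_lt with rfl | hlt
  · rfl
  · exact h ⟨hlt, hs'⟩

theorem jumpTime_succ_le {k : ℕ} {t : ℝ≥0} (h : jumpTime x k < t) (ht : x t ≠ embedded x k) :
    jumpTime x (k + 1) ≤ t :=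
  iInf₂_le t ⟨h, ht⟩

theorem le_jumpTime_succ {k : ℕ} {c : ℝ≥0∞}
    (h : ∀ t : ℝ≥0, jumpTime x k < t → x t ≠ embedded x k → c ≤ t) : c ≤ jumpTime x (k + 1) :=
  le_iInf₂ fun t ht => h t ht.1 ht.2

theorem jumpTime_mono (x : ℝ≥0 → S) : Monotone (jumpTime x) :=
  monotone_nat_of_le_succ fun _ => le_jumpTime_succ fun _ ht _ => ht.le

theorem jumpTime_lt_succ (hx : IsRightContinuous x) {k : ℕ} (hk : jumpTime x k ≠ ∞) :
    jumpTime x k < jumpTime x (k + 1) := by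
  obtain ⟨u, hu, h⟩ := hx.exists_gt (jumpTime x k).toNNReal
  have e := ENNReal.coe_toNNReal hk
  have hu' : jumpTime x k < u := by rw [← e]; exact_mod_cast hu
  refine hu'.trans_le (le_jumpTime_succ fun t ht hne => ?_)
  by_contra! hc
  refine hne (h t ?_ (by exact_mod_cast hc))
  rw [← e] at ht
  exact_mod_cast ht.le

theorem eq_embedded {k : ℕ} {t : ℝ≥0} (h : jumpTime x k ≤ t) (h' : t < jumpTime x (k + 1)) :
    x t = embedded x k := by
  rcases h.eq_or_lt with he | hlt
  · rw [embedded, he, ENNReal.toNNReal_coe]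
  · by_contra hc
    exact absurd (jumpTime_succ_le hlt hc) (not_le.2 h')

theorem embedded_succ_ne (hx : IsRightContinuous x) {k : ℕ} (hk : jumpTime x (k + 1) ≠ ∞) :
    embedded x (k + 1) ≠ embedded x k := by
  intro heq
  obtain ⟨u, hu, h⟩ := hx.exists_gt (jumpTime x (k + 1)).toNNReal
  have e := ENNReal.coe_toNNReal hk
  have hu' : jumpTime x (k + 1) < u := by rw [← e]; exact_mod_cast hu
  refine absurd (le_jumpTime_succ (x := x) (k := k) (c := u) fun t ht hne => ?_) (not_le.2 hu')
  by_contra! hc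
  refine hne ((h t ?_ (by exact_mod_cast hc)).trans heq)
  have := jumpTime_succ_le ht hne
  rw [← e] at this
  exact_mod_cast this

theorem exists_mem_jump_interval {K : ℕ} {t : ℝ≥0} (h : t < jumpTime x K) :
    ∃ k < K, jumpTime x k ≤ t ∧ t < jumpTime x (k + 1) := by
  induction K with
  | zero => simp [jumpTime] at h
  | succ K ih =>
    by_cases h' : t < jumpTime x K
    · obtain ⟨k, hk, h1⟩ := ih h'
      exact ⟨k, hk.trans (Nat.lt_succ_self K), h1⟩
    · exact ⟨K, Nat.lt_succ_self K, not_lt.1 h', h⟩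

/-- The list `[y k, …, y 0]`. -/
def revPath (y : ℕ → S) : ℕ → List S
  | 0 => [y 0]
  | k + 1 => y (k + 1) :: revPath y k

@[simp] theorem length_revPath (y : ℕ → S) (k : ℕ) : (revPath y k).length = k + 1 := by
  induction k with
  | zero => rfl
  | succ k ih => simp [revPath, ih]

theorem head?_revPath (y : ℕ → S) (k : ℕ) : (revPath y k).head? = some (y k) := by
  cases k <;> rfl

theorem eq_of_revPath_eq_cons {y : ℕ → S} {k : ℕ} {a : S} {l : List S}
    (h : revPath y k = a :: l) : y k = a := by
  simpa [h] using (head?_revPath y k).symm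

theorem revPath_succ_eq_cons_iff {y : ℕ → S} {k : ℕ} {b : S} {l : List S} :
    revPath y (k + 1) = b :: l ↔ y (k + 1) = b ∧ revPath y k = l := by
  simp [revPath]

/-- Each of the first `K + 1` jump intervals of the path is longer than the mesh `h`, so that it
contains a point of the grid. -/
def GridResolves (x : ℝ≥0 → S) (h : ℝ≥0) (K : ℕ) : Prop :=
  ∀ k ≤ K, jumpTime x k ≠ ∞ → jumpTime x k + h < jumpTime x (k + 1)

theorem GridResolves.mono {h : ℝ≥0} {K K' : ℕ} (hg : GridResolves x h K') (hK : K ≤ K') :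
    GridResolves x h K := fun k hk => hg k (hk.trans hK)

theorem eventually_gridResolves (hx : IsRightContinuous x) {h : ℕ → ℝ≥0}
    (hlim : Tendsto h atTop (𝓝 0)) (K : ℕ) : ∀ᶠ n in atTop, GridResolves x (h n) K := by
  refine (eventually_all_finite (Set.finite_Iic K)).2 fun k _ => ?_
  by_cases hk : jumpTime x k = ∞
  · simp [hk]
  have h1 : Tendsto (fun n => jumpTime x k + (h n : ℝ≥0∞)) atTop (𝓝 (jumpTime x k + (0 : ℝ≥0))) :=
    tendsto_const_nhds.add (ENNReal.tendsto_coe.2 hlim)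
  rw [ENNReal.coe_zero, add_zero] at h1
  filter_upwards [h1.eventually_lt_const (jumpTime_lt_succ hx hk)] with n hn _ using hn

theorem coe_succ_mul (m : ℕ) (h : ℝ≥0) :
    (((m + 1 : ℕ) * h : ℝ≥0) : ℝ≥0∞) = ((m * h : ℝ≥0) : ℝ≥0∞) + h := by
  rw [← ENNReal.coe_add]; congr 1; push_cast; ring

/-- On a fine grid, the history of the sampled path is the list of the states at the jump times. -/
theorem history_eq_revPath (hx : IsRightContinuous x) {h : ℝ≥0} {K : ℕ}
    (hg : GridResolves x h K) {m k : ℕ} (hk : k ≤ K) (h1 : jumpTime x k ≤ (m * h : ℝ≥0))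
    (h2 : (m * h : ℝ≥0) < jumpTime x (k + 1)) :
    history (fun m : ℕ => x (m * h)) m = revPath (embedded x) k := by
  induction m generalizing k with
  | zero =>
    cases k with
    | zero => simp [history, revPath, embedded, jumpTime]
    | succ k =>
      simp only [Nat.cast_zero, zero_mul, ENNReal.coe_zero, nonpos_iff_eq_zero] at h1
      have h0 : jumpTime x k = 0 := by simpa [h1] using jumpTime_mono x (Nat.le_succ k)
      have := jumpTime_lt_succ hx (k := k) (by simp [h0])
      simp [h1] at this
  | succ m ih =>
    have hv := eq_embedded h1 h2
    have hle : ((m * h : ℝ≥0) : ℝ≥0∞) ≤ ((m + 1 : ℕ) * h : ℝ≥0) := by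
      rw [coe_succ_mul]; exact le_self_add
    by_cases h3 : jumpTime x k ≤ (m * h : ℝ≥0)
    · have h4 := hle.trans_lt h2
      rw [history_succ_of_eq (hv.trans (eq_embedded h3 h4).symm)]
      exact ih hk h3 h4
    · rw [not_le] at h3
      cases k with
      | zero => simp [jumpTime] at h3
      | succ k =>
        have hfin : jumpTime x (k + 1) ≠ ∞ := ne_top_of_le_ne_top ENNReal.coe_ne_top h1
        have h4 : jumpTime x k ≤ (m * h : ℝ≥0) := by
          have := (hg k (Nat.le_of_succ_le hk)
            (ne_top_of_le_ne_top hfin (jumpTime_mono x (Nat.le_succ k)))).trans_le h1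
          rw [coe_succ_mul] at this
          exact ((ENNReal.add_lt_add_iff_right ENNReal.coe_ne_top).1 this).le
        have hne : x ((m + 1 : ℕ) * h) ≠ x (m * h) := by
          rw [hv, eq_embedded h4 h3]; exact embedded_succ_ne hx hfin
        rw [history_succ_of_ne (y := fun m : ℕ => x (m * h)) hne,
          ih (Nat.le_of_succ_le hk) h4 h3, revPath, ← hv]

/-- On a fine grid, the sampled path has seen every jump that has occurred. -/
theorem lt_length_history (hx : IsRightContinuous x) {h : ℝ≥0} {K : ℕ}
    (hg : GridResolves x h K) {m k : ℕ} (hk : k ≤ K) (h1 : jumpTime x k ≤ (m * h : ℝ≥0)) :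
    k < (history (fun m : ℕ => x (m * h)) m).length := by
  have hfin : jumpTime x k ≠ ∞ := ne_top_of_le_ne_top ENNReal.coe_ne_top h1
  by_cases h2 : ((m * h : ℝ≥0) : ℝ≥0∞) < jumpTime x (k + 1)
  · rw [history_eq_revPath hx hg hk h1 h2]; simp
  · induction m with
    | zero =>
      have := (zero_le (a := jumpTime x k)).trans_lt (jumpTime_lt_succ hx hfin)
      simp [this] at h2
    | succ m ih =>
      by_cases h3 : jumpTime x k ≤ (m * h : ℝ≥0)
      · refine lt_of_lt_of_le ?_ (length_history_mono _ (Nat.le_succ m))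
        by_cases h4 : ((m * h : ℝ≥0) : ℝ≥0∞) < jumpTime x (k + 1)
        · dsimp only
          rw [history_eq_revPath hx hg hk h3 h4]; simp
        · exact ih h3 h4
      · refine absurd (lt_of_le_of_lt ?_ (hg k hk hfin)) h2
        rw [coe_succ_mul]
        exact add_le_add_left (not_le.1 h3).le _

/-- On a fine grid, the sampled path has the history `l` for the first time at the first grid point
after the jump at which the path has visited the states in `l`. -/
theorem firstHistory_iff (hx : IsRightContinuous x) {h : ℝ≥0} (h0 : 0 < h) {k : ℕ}
    (hg : GridResolves x h (k + 1)) {l : List S} (hl : l.length = k + 1) (m : ℕ) :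
    FirstHistory (fun m : ℕ => x (m * h)) l m ↔
      revPath (embedded x) k = l ∧ jumpTime x k ≤ (m * h : ℝ≥0) ∧
        (m * h : ℝ≥0) < jumpTime x k + h := by
  have hg' := hg.mono (Nat.le_succ k)
  -- before the `k`-th jump, the history is too short
  have early {m' : ℕ} (h' : ((m' * h : ℝ≥0) : ℝ≥0∞) < jumpTime x k) :
      history (fun m : ℕ => x (m * h)) m' ≠ l := by
    obtain ⟨k', hk', h1, h2⟩ := exists_mem_jump_interval h'
    intro hc
    have := congrArg List.length hc
    rw [history_eq_revPath hx hg' hk'.le h1 h2, length_revPath, hl] at this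
    omega
  constructor
  · rintro ⟨h1, h2⟩
    have h3 : ((m * h : ℝ≥0) : ℝ≥0∞) < jumpTime x (k + 1) := by
      by_contra! hc
      have := lt_length_history hx hg le_rfl hc
      rw [h1, hl] at this
      omega
    have h4 : jumpTime x k ≤ (m * h : ℝ≥0) := by
      by_contra! hc
      exact early hc h1
    have h5 := history_eq_revPath hx hg' le_rfl h4 h3
    refine ⟨h5.symm.trans h1, h4, ?_⟩
    by_contra! hc
    cases m with
    | zero =>
      have : (h : ℝ≥0∞) ≤ 0 := le_add_self.trans (by simpa using hc)
      simp [h0.ne'] at this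
    | succ m =>
      rw [coe_succ_mul] at hc h3
      have h6 := (ENNReal.add_le_add_iff_right ENNReal.coe_ne_top).1 hc
      refine h2 m (Nat.lt_succ_self m) ?_
      rw [history_eq_revPath hx hg' le_rfl h6 (lt_of_le_of_lt le_self_add h3), ← h5, h1]
  · rintro ⟨h1, h2, h3⟩
    have hfin : jumpTime x k ≠ ∞ := ne_top_of_le_ne_top ENNReal.coe_ne_top h2
    refine ⟨(history_eq_revPath hx hg' le_rfl h2 (h3.trans (hg k (Nat.le_succ k) hfin))).trans h1,
      fun m' hm' => early ?_⟩
    have h4 : (((m' + 1 : ℕ) * h : ℝ≥0) : ℝ≥0∞) ≤ (m * h : ℝ≥0) := by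
      exact_mod_cast mul_le_mul_of_nonneg_right (Nat.cast_le.2 hm') zero_le
    have := h4.trans_lt h3
    rw [coe_succ_mul] at this
    exact (ENNReal.add_lt_add_iff_right ENNReal.coe_ne_top).1 this

end PathLemmas

/-! ### Laplace transforms of the jump times -/

theorem tendsto_mesh : Tendsto (fun n : ℕ => 1 / ((n : ℝ≥0) + 1)) atTop (𝓝 0) :=
  tendsto_one_div_add_atTop_nhds_zero_nat

theorem mesh_pos (n : ℕ) : 0 < 1 / ((n : ℝ≥0) + 1) := by positivity

section Discount

variable {S : Type*} {x : ℝ≥0 → S}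

/-- The discount factor `e ^ (-c * s)`. For `s = ∞` it is `0`, even if `c = 0`, so that `discount 0`
indicates the finite times. -/
noncomputable def discount (c : ℝ≥0) (s : ℝ≥0∞) : ℝ≥0∞ :=
  if s = ∞ then 0 else ENNReal.ofReal (Real.exp (-(c * s.toReal)))

theorem discount_of_ne_top (c : ℝ≥0) {s : ℝ≥0∞} (hs : s ≠ ∞) :
    discount c s = ENNReal.ofReal (Real.exp (-(c * s.toReal))) := if_neg hs

theorem discount_top (c : ℝ≥0) : discount c ∞ = 0 := if_pos rfl

theorem discount_le_one (c : ℝ≥0) (s : ℝ≥0∞) : discount c s ≤ 1 := by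
  by_cases hs : s = ∞
  · simp [hs, discount_top]
  · rw [discount_of_ne_top c hs]
    have : 0 ≤ c * s.toReal := mul_nonneg c.2 ENNReal.toReal_nonneg
    simpa using this

open scoped Classical in
/-- The discount factor of the `k`-th jump time, on the event that `l` lists the first `k + 1`
states of the embedded path, the latest first. -/
noncomputable def discountedVisit (c : ℝ≥0) (x : ℝ≥0 → S) (k : ℕ) (l : List S) : ℝ≥0∞ :=
  if revPath (embedded x) k = l then discount c (jumpTime x k) else 0

open scoped Classical in
/-- The discount factor of the time at which the path sampled with mesh `h` has the history `l` for
the first time, and `0` if there is no such time. -/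
noncomputable def sampledVisit (c h : ℝ≥0) (x : ℝ≥0 → S) (l : List S) : ℝ≥0∞ :=
  ∑' m : ℕ, ENNReal.ofReal (Real.exp (-(c * h))) ^ m *
    if FirstHistory (fun m : ℕ => x (m * h)) l m then 1 else 0

theorem sampledVisit_of_firstHistory (c h : ℝ≥0) {l : List S} {m : ℕ}
    (hm : FirstHistory (fun m : ℕ => x (m * h)) l m) :
    sampledVisit c h x l = discount c (m * h : ℝ≥0) := by
  rw [sampledVisit, tsum_eq_single m, if_pos hm, mul_one, discount_of_ne_top c ENNReal.coe_ne_top,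
    ← ENNReal.ofReal_pow (Real.exp_nonneg _), ← Real.exp_nat_mul]
  · congr 2
    rw [ENNReal.coe_toReal]; push_cast; ring
  · intro m' hm'
    rw [if_neg fun h' => hm' (h'.unique hm), mul_zero]

theorem sampledVisit_of_forall_not (c h : ℝ≥0) {l : List S}
    (hm : ∀ m, ¬ FirstHistory (fun m : ℕ => x (m * h)) l m) : sampledVisit c h x l = 0 := by
  simp [sampledVisit, hm]

theorem sampledVisit_le_one (c h : ℝ≥0) (x : ℝ≥0 → S) (l : List S) :
    sampledVisit c h x l ≤ 1 := by
  by_cases hm : ∃ m, FirstHistory (fun m : ℕ => x (m * h)) l m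
  · obtain ⟨m, hm⟩ := hm
    rw [sampledVisit_of_firstHistory c h hm]
    exact discount_le_one _ _
  · rw [sampledVisit_of_forall_not c h (not_exists.1 hm)]
    exact zero_le_one

/-- The sampled path approximates the embedded path and its jump times, whatever the path is: it may
jump only finitely often, or explode. -/
theorem tendsto_sampledVisit (hx : IsRightContinuous x) (c : ℝ≥0) {h : ℕ → ℝ≥0}
    (h0 : ∀ n, 0 < h n) (hlim : Tendsto h atTop (𝓝 0)) {k : ℕ} {l : List S}
    (hl : l.length = k + 1) :
    Tendsto (fun n => sampledVisit c (h n) x l) atTop (𝓝 (discountedVisit c x k l)) := by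
  have hg := eventually_gridResolves hx hlim (k + 1)
  by_cases hl' : revPath (embedded x) k = l ∧ jumpTime x k ≠ ∞
  · obtain ⟨hl', hfin⟩ := hl'
    rw [discountedVisit, if_pos hl']
    set J := (jumpTime x k).toNNReal with hJ
    have eJ : jumpTime x k = J := (ENNReal.coe_toNNReal hfin).symm
    -- the first grid point that is not before the jump time
    let m : ℕ → ℕ := fun n => ⌈J / h n⌉₊
    have h1 (n : ℕ) : J ≤ m n * h n := (div_le_iff₀ (h0 n)).1 (Nat.le_ceil _)
    have h2 (n : ℕ) : m n * h n < J + h n := by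
      have := mul_lt_mul_of_pos_right (Nat.ceil_lt_add_one (zero_le (a := J / h n))) (h0 n)
      rwa [add_mul, one_mul, div_mul_cancel₀ _ (h0 n).ne'] at this
    have hm : ∀ᶠ n in atTop, sampledVisit c (h n) x l = discount c (m n * h n : ℝ≥0) := by
      filter_upwards [hg] with n hn
      refine sampledVisit_of_firstHistory c (h n) ((firstHistory_iff hx (h0 n) hn hl _).2
        ⟨hl', ?_, ?_⟩)
      · rw [eJ]; exact_mod_cast h1 n
      · rw [eJ]; exact_mod_cast h2 n
    refine Tendsto.congr' (hm.mono fun n hn => hn.symm) ?_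
    have h3 : Tendsto (fun n => m n * h n) atTop (𝓝 J) := by
      refine tendsto_of_tendsto_of_tendsto_of_le_of_le tendsto_const_nhds ?_ h1 fun n => (h2 n).le
      simpa using tendsto_const_nhds.add hlim
    simp only [discount_of_ne_top c ENNReal.coe_ne_top, eJ, ENNReal.coe_toReal]
    refine ENNReal.tendsto_ofReal ((Real.continuous_exp.tendsto _).comp ?_)
    exact ((NNReal.continuous_coe.tendsto J).comp h3).const_mul (c : ℝ) |>.neg
  · have e : discountedVisit c x k l = 0 := by
      unfold discountedVisit
      split_ifs with h
      · rw [not_not.1 fun h' => hl' ⟨h, h'⟩, discount_top]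
      · rfl
    rw [e]
    refine tendsto_const_nhds.congr' (hg.mono fun n hn => ?_)
    refine (sampledVisit_of_forall_not c (h n) fun m hm => hl' ?_).symm
    have := (firstHistory_iff hx (h0 n) hn hl m).1 hm
    exact ⟨this.1, ne_top_of_le_ne_top ENNReal.coe_ne_top this.2.1⟩

theorem discountedVisit_le_one (c : ℝ≥0) (x : ℝ≥0 → S) (k : ℕ) (l : List S) :
    discountedVisit c x k l ≤ 1 := by
  unfold discountedVisit
  split_ifs
  · exact discount_le_one _ _
  · exact zero_le_one

theorem discountedVisit_of_length_ne (c : ℝ≥0) (x : ℝ≥0 → S) {k : ℕ} {l : List S}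
    (hl : l.length ≠ k + 1) : discountedVisit c x k l = 0 :=
  if_neg fun h => hl (by rw [← h, length_revPath])

end Discount

namespace IsMarkovChain

variable {S Ω : Type*} [MeasurableSpace Ω] {γ : Network S} {ℙ : S → Measure Ω}
  {X : ℝ≥0 → Ω → S}

theorem isRightContinuous (hX : IsMarkovChain γ ℙ X) (ω : Ω) :
    IsRightContinuous fun t => X t ω := hX.rightContinuous ω

theorem hasTransition (hX : IsMarkovChain γ ℙ X) (j : S) (h : ℝ≥0) :
    HasTransition (ℙ j) (fun m : ℕ => X (m * h))
      fun a b => ENNReal.ofReal (γ.transition h b a) := by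
  intro n s i
  have := hX.markov j n (fun k => (k : ℕ) * h)
    (fun k k' hk => mul_le_mul_of_nonneg_right (Nat.cast_le.2 hk) zero_le) s h i
  rw [← this]
  simp [add_mul]

theorem ofReal_transition_le_one (hX : IsMarkovChain γ ℙ X) (h : ℝ≥0) (a b : S) :
    ENNReal.ofReal (γ.transition h b a) ≤ 1 := by
  have := hX.isProbabilityMeasure a
  have h1 := hX.markov a 0 (fun _ => 0) monotone_const (fun _ => a) h b
  simp only [forall_const, hX.start, one_mul] at h1
  rw [← h1]
  exact prob_le_one

variable [Countable S]

theorem lintegral_sampledVisit (hX : IsMarkovChain γ ℙ X) (j : S) (c h : ℝ≥0) (l : List S) :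
    ∫⁻ ω, sampledVisit c h (fun t => X t ω) l ∂(ℙ j) =
      firstHistoryGen (ℙ j) (fun m : ℕ => X (m * h)) (ENNReal.ofReal (Real.exp (-(c * h)))) l := by
  classical
  have hm (m : ℕ) := measurableSet_firstHistory (y := fun m : ℕ => X (m * h))
    (fun n i => hX.measurableSet _ i) m l
  unfold sampledVisit firstHistoryGen
  rw [lintegral_tsum fun m => (Measurable.ite (hm m) measurable_const
    measurable_const |>.const_mul _).aemeasurable]
  refine tsum_congr fun m => ?_
  rw [lintegral_const_mul _ (Measurable.ite (hm m) measurable_const measurable_const)]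
  congr 1
  rw [← lintegral_indicator_one (hm m)]
  rfl

theorem measurable_sampledVisit (hX : IsMarkovChain γ ℙ X) (c h : ℝ≥0) (l : List S) :
    Measurable fun ω => sampledVisit c h (fun t => X t ω) l := by
  classical
  refine Measurable.tsum fun m => Measurable.const_mul (Measurable.ite ?_ measurable_const
    measurable_const) _
  exact measurableSet_firstHistory (y := fun m : ℕ => X (m * h))
    (fun n i => hX.measurableSet _ i) m l

theorem measurable_discountedVisit (hX : IsMarkovChain γ ℙ X) (c : ℝ≥0) (k : ℕ) (l : List S) :
    Measurable fun ω => discountedVisit c (fun t => X t ω) k l := by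
  by_cases hl : l.length = k + 1
  · refine measurable_of_tendsto_metrizable (fun n => hX.measurable_sampledVisit c _ l)
      (tendsto_pi_nhds.2 fun ω =>
        tendsto_sampledVisit (hX.isRightContinuous ω) c mesh_pos tendsto_mesh hl)
  · simp only [discountedVisit_of_length_ne c _ hl, measurable_const]

theorem tendsto_firstHistoryGen (hX : IsMarkovChain γ ℙ X) (j : S) (c : ℝ≥0) {k : ℕ} {l : List S}
    (hl : l.length = k + 1) :
    Tendsto (fun n : ℕ => firstHistoryGen (ℙ j) (fun m : ℕ => X (m * (1 / ((n : ℝ≥0) + 1))))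
      (ENNReal.ofReal (Real.exp (-(c * (1 / ((n : ℝ≥0) + 1) : ℝ≥0))))) l) atTop
      (𝓝 (∫⁻ ω, discountedVisit c (fun t => X t ω) k l ∂(ℙ j))) := by
  have := hX.isProbabilityMeasure j
  simp only [← hX.lintegral_sampledVisit]
  refine tendsto_lintegral_of_dominated_convergence (fun _ => 1)
    (fun n => hX.measurable_sampledVisit c _ l)
    (fun n => Eventually.of_forall fun ω => sampledVisit_le_one _ _ _ _) (by simp)
    (Eventually.of_forall fun ω =>
        tendsto_sampledVisit (hX.isRightContinuous ω) c mesh_pos tendsto_mesh hl)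

end IsMarkovChain

/-- The factor of `toReal_firstHistoryGen_cons_cons` for the sampled chain, in the limit of a fine
grid. -/
theorem Network.tendsto_jump_factor {S : Type*} (γ : Network S) {c : ℝ≥0} (hc : 0 < c)
    {a b : S} (hab : a ≠ b) {h : ℕ → ℝ≥0} (h0 : ∀ n, 0 < h n) (hlim : Tendsto h atTop (𝓝 0)) :
    Tendsto (fun n => Real.exp (-(c * h n)) * (ENNReal.ofReal (γ.transition (h n) b a)).toReal /
      (1 - Real.exp (-(c * h n)) * (ENNReal.ofReal (γ.transition (h n) a a)).toReal)) atTop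
      (𝓝 (γ.rate a b / (c + γ.exitRate a))) := by
  have hl : Tendsto (fun n => (h n : ℝ)) atTop (𝓝 0) := (NNReal.continuous_coe.tendsto 0).comp hlim
  have hl' : Tendsto (fun n => (h n : ℝ)) atTop (𝓝[≠] 0) :=
    tendsto_nhdsWithin_iff.2 ⟨hl, Eventually.of_forall fun n => by simpa using (h0 n).ne'⟩
  have hr : Tendsto (fun n => Real.exp (-(c * h n))) atTop (𝓝 1) := by
    simpa [Function.comp_def] using (Real.continuous_exp.tendsto _).comp (hl.const_mul (c : ℝ)).neg
  have hr' : Tendsto (fun n => (1 - Real.exp (-(c * h n))) / (h n : ℝ)) atTop (𝓝 c) := by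
    have h1 : HasDerivAt (fun t : ℝ => Real.exp (-(c * t))) (-c) 0 := by
      simpa using ((hasDerivAt_id (0 : ℝ)).const_mul (c : ℝ)).neg.exp
    have h2 := (h1.tendsto_slope_zero.comp hl').neg
    rw [neg_neg] at h2
    refine h2.congr fun n => ?_
    simp only [Function.comp, smul_eq_mul, zero_add, mul_zero, neg_zero, Real.exp_zero]
    rw [div_eq_inv_mul]; ring
  have hb : Tendsto (fun n => (ENNReal.ofReal (γ.transition (h n) b a)).toReal / (h n : ℝ)) atTop
      (𝓝 (γ.rate a b)) := by
    have h1 := γ.tendsto_transition_slope b a h0 hlim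
    simp only [if_neg hab.symm, sub_zero, Network.entry] at h1
    have h2 := h1.max (tendsto_const_nhds (x := (0 : ℝ)))
    rw [max_eq_left (NNReal.coe_nonneg _)] at h2
    refine h2.congr fun n => ?_
    rw [ENNReal.toReal_ofReal', ← max_div_div_right (NNReal.coe_nonneg (h n)), zero_div]
  have ha : Tendsto (fun n => (1 - (ENNReal.ofReal (γ.transition (h n) a a)).toReal) / (h n : ℝ))
      atTop (𝓝 (γ.exitRate a)) := by
    have h1 := γ.tendsto_transition_slope a a h0 hlim
    simp only [if_true, Network.entry] at h1
    have h2 : Tendsto (fun n => γ.transition (h n) a a) atTop (𝓝 1) := by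
      have := (h1.mul hl).add_const 1
      simp only [mul_zero, zero_add] at this
      refine this.congr fun n => ?_
      have := (NNReal.coe_pos.2 (h0 n)).ne'
      field_simp
      ring
    have h3 := h1.neg
    rw [neg_neg] at h3
    refine h3.congr' ?_
    filter_upwards [h2.eventually_const_lt zero_lt_one] with n hn
    rw [ENNReal.toReal_ofReal hn.le]
    ring
  have hd := (hr.mul hb).div (hr'.add (hr.mul ha)) (by positivity)
  simp only [one_mul] at hd
  refine hd.congr fun n => ?_
  have := (NNReal.coe_pos.2 (h0 n)).ne'
  rw [Pi.div_apply, mul_div_assoc', mul_div_assoc', ← add_div, div_div_div_cancel_right₀ this]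
  congr 1
  ring

/-- The limit of `toReal_firstHistoryGen_cons_cons` along grids whose mesh tends to `0`. The discount
rate has to be positive for the generating functions to converge. -/
theorem IsMarkovChain.lintegral_discountedVisit_succ {S Ω : Type*} [MeasurableSpace Ω]
    {γ : Network S} {ℙ : S → Measure Ω} {X : ℝ≥0 → Ω → S} [Countable S]
    (hX : IsMarkovChain γ ℙ X) (j : S) {c : ℝ≥0} (hc : 0 < c) (k : ℕ) (a b : S) (l : List S) :
    ∫⁻ ω, discountedVisit c (fun t => X t ω) (k + 1) (b :: a :: l) ∂(ℙ j) =
      (∫⁻ ω, discountedVisit c (fun t => X t ω) k (a :: l) ∂(ℙ j)) *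
        (γ.rate a b / (c + γ.exitRate a) : ℝ≥0) := by
  have := hX.isProbabilityMeasure j
  by_cases hl : (a :: l).length = k + 1
  swap
  · have hl' : (b :: a :: l).length ≠ k + 1 + 1 := fun h => hl (by simpa using h)
    simp [discountedVisit_of_length_ne c _ hl, discountedVisit_of_length_ne c _ hl']
  by_cases hab : a = b
  · -- there is no jump from a state to itself, and `rate a a = 0`
    subst hab
    rw [γ.rate_self, zero_div, ENNReal.coe_zero, mul_zero]
    refine (lintegral_congr fun ω => ?_).trans lintegral_zero
    unfold discountedVisit
    split_ifs with h
    · rw [revPath_succ_eq_cons_iff] at h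
      by_contra hJ
      refine embedded_succ_ne (hX.isRightContinuous ω) (k := k) (fun hJ' => hJ ?_)
        (h.1.trans (eq_of_revPath_eq_cons h.2).symm)
      rw [hJ', discount_top]
    · rfl
  have hl' : (b :: a :: l).length = k + 1 + 1 := by simpa using hl
  have fin (k : ℕ) (l : List S) : ∫⁻ ω, discountedVisit c (fun t => X t ω) k l ∂(ℙ j) ≠ ∞ := by
    refine ne_top_of_le_ne_top ENNReal.one_ne_top ?_
    calc _ ≤ ∫⁻ _, 1 ∂(ℙ j) := lintegral_mono fun ω => discountedVisit_le_one _ _ _ _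
      _ = 1 := by simp
  have t1 := (ENNReal.tendsto_toReal (fin (k + 1) _)).comp (hX.tendsto_firstHistoryGen j c hl')
  have t2 := ((ENNReal.tendsto_toReal (fin k _)).comp (hX.tendsto_firstHistoryGen j c hl)).mul
    (γ.tendsto_jump_factor hc hab mesh_pos tendsto_mesh)
  have h := tendsto_nhds_unique t1 (t2.congr fun n => ?_)
  · rw [← ENNReal.toReal_eq_toReal_iff' (fin _ _) (ENNReal.mul_ne_top (fin _ _)
      ENNReal.coe_ne_top), h, ENNReal.toReal_mul]
    simp
  · have hr : ENNReal.ofReal (Real.exp (-(c * (1 / ((n : ℝ≥0) + 1) : ℝ≥0)))) < 1 := by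
      have : (0 : ℝ) < c * (1 / ((n : ℝ≥0) + 1) : ℝ≥0) :=
        mul_pos hc (NNReal.coe_pos.2 (mesh_pos n))
      rw [← ENNReal.ofReal_one]
      exact (ENNReal.ofReal_lt_ofReal_iff one_pos).2 (by simpa using this)
    have := toReal_firstHistoryGen_cons_cons (fun m i => hX.measurableSet _ i)
      (hX.hasTransition j (1 / ((n : ℝ≥0) + 1))) hr hab l (hX.ofReal_transition_le_one _ _ _)
    rw [ENNReal.toReal_ofReal (Real.exp_nonneg _)] at this
    exact this.symm

/-! ### Jumps and holding times of the chain -/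

theorem discount_antitone (c : ℝ≥0) : Antitone (discount c) := by
  intro s t h
  by_cases ht : t = ∞
  · simp [ht, discount_top]
  · have hs := ne_top_of_le_ne_top ht h
    rw [discount_of_ne_top c ht, discount_of_ne_top c hs]
    refine ENNReal.ofReal_le_ofReal (Real.exp_le_exp.2 (neg_le_neg ?_))
    exact mul_le_mul_of_nonneg_left (ENNReal.toReal_mono ht h) c.2

theorem discount_ne_zero (c : ℝ≥0) {s : ℝ≥0∞} (hs : s ≠ ∞) : discount c s ≠ 0 := by
  rw [discount_of_ne_top c hs]
  simpa using Real.exp_pos _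

theorem discount_zero {s : ℝ≥0∞} (hs : s ≠ ∞) : discount 0 s = 1 := by
  simp [discount_of_ne_top 0 hs]

theorem tendsto_discount_zero {c : ℕ → ℝ≥0} (hc : Tendsto c atTop (𝓝 0)) (s : ℝ≥0∞) :
    Tendsto (fun n => discount (c n) s) atTop (𝓝 (discount 0 s)) := by
  by_cases hs : s = ∞
  · simp [hs, discount_top]
  · simp only [discount_of_ne_top _ hs]
    refine ENNReal.tendsto_ofReal ((Real.continuous_exp.tendsto _).comp ?_)
    exact (((NNReal.continuous_coe.tendsto 0).comp hc).mul_const _).neg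

section DiscountDifference

/-- The difference quotient `(e ^ (-c s) - e ^ (-c t)) / c`, which increases to `t - s` as `c`
decreases to `0` along the powers of `1 / 2`. -/
noncomputable def discountQuotient (c : ℝ≥0) (s t : ℝ≥0∞) : ℝ≥0∞ :=
  (discount c s - discount c t) / c

theorem discountQuotient_eq {c : ℝ≥0} (hc : 0 < c) {s t : ℝ≥0∞} (hs : s ≠ ∞) (ht : t ≠ ∞) :
    discountQuotient c s t =
      ENNReal.ofReal ((Real.exp (-(c * s.toReal)) - Real.exp (-(c * t.toReal))) / c) := by
  rw [discountQuotient, discount_of_ne_top c hs, discount_of_ne_top c ht,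
    ← ENNReal.ofReal_sub _ (Real.exp_nonneg _), ENNReal.ofReal_div_of_pos (NNReal.coe_pos.2 hc),
    ENNReal.ofReal_coe_nnreal]

theorem discountQuotient_le_half {c : ℝ≥0} (hc : 0 < c) {s t : ℝ≥0∞} (hst : s ≤ t) (ht : t ≠ ∞) :
    discountQuotient c s t ≤ discountQuotient (c / 2) s t := by
  have hs := ne_top_of_le_ne_top ht hst
  have hst' := ENNReal.toReal_mono ht hst
  have hc' : (0 : ℝ) < c := hc
  rw [discountQuotient_eq hc hs ht, discountQuotient_eq (half_pos hc) hs ht]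
  refine ENNReal.ofReal_le_ofReal ?_
  have e (u : ℝ) : Real.exp (-(c * u)) = Real.exp (-((c / 2 : ℝ≥0) * u)) ^ 2 := by
    rw [← Real.exp_nat_mul]; congr 1; push_cast; ring
  have h1 : Real.exp (-((c / 2 : ℝ≥0) * t.toReal)) ≤ Real.exp (-((c / 2 : ℝ≥0) * s.toReal)) :=
    Real.exp_le_exp.2 (neg_le_neg (mul_le_mul_of_nonneg_left hst' (NNReal.coe_nonneg _)))
  have h2 : Real.exp (-((c / 2 : ℝ≥0) * s.toReal)) ≤ 1 := by
    rw [Real.exp_le_one_iff, neg_nonpos]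
    exact mul_nonneg (NNReal.coe_nonneg _) ENNReal.toReal_nonneg
  rw [e, e]
  set A := Real.exp (-((c / 2 : ℝ≥0) * s.toReal))
  set B := Real.exp (-((c / 2 : ℝ≥0) * t.toReal))
  rw [NNReal.coe_div, NNReal.coe_ofNat, div_div_eq_mul_div]
  refine div_le_div_of_nonneg_right ?_ hc'.le
  nlinarith [mul_nonneg (sub_nonneg.2 h1) (by linarith : 0 ≤ 2 - (A + B))]

theorem tendsto_discountQuotient {c : ℕ → ℝ≥0} (hc0 : ∀ n, 0 < c n)
    (hc : Tendsto c atTop (𝓝 0)) {s t : ℝ≥0∞} (hs : s ≠ ∞) (ht : t ≠ ∞) :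
    Tendsto (fun n => discountQuotient (c n) s t) atTop (𝓝 (t - s)) := by
  simp only [fun n => discountQuotient_eq (hc0 n) hs ht]
  have e : t - s = ENNReal.ofReal (t.toReal - s.toReal) := by
    rw [ENNReal.ofReal_sub _ ENNReal.toReal_nonneg, ENNReal.ofReal_toReal hs,
      ENNReal.ofReal_toReal ht]
  rw [e]
  refine ENNReal.tendsto_ofReal ?_
  have hc' : Tendsto (fun n => (c n : ℝ)) atTop (𝓝[≠] 0) :=
    tendsto_nhdsWithin_iff.2 ⟨(NNReal.continuous_coe.tendsto 0).comp hc,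
      Eventually.of_forall fun n => by simpa using (hc0 n).ne'⟩
  have hd (u : ℝ) : HasDerivAt (fun r : ℝ => Real.exp (-(r * u))) (-u) 0 := by
    simpa using ((hasDerivAt_id (0 : ℝ)).mul_const u).neg.exp
  have h := ((hd s.toReal).sub (hd t.toReal)).tendsto_slope_zero.comp hc'
  rw [show -s.toReal - -t.toReal = t.toReal - s.toReal by ring] at h
  refine h.congr fun n => ?_
  simp [div_eq_inv_mul]

end DiscountDifference

section PathSums

variable {S : Type*} (x : ℝ≥0 → S)

open scoped Classical in
theorem tsum_discountedVisit (c : ℝ≥0) (k : ℕ) :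
    ∑' l, discountedVisit c x k l = discount c (jumpTime x k) := by
  simp [discountedVisit]

open scoped Classical in
theorem tsum_discountedVisit_succ (c : ℝ≥0) (k : ℕ) (l : List S) :
    ∑' b, discountedVisit c x (k + 1) (b :: l) =
      if revPath (embedded x) k = l then discount c (jumpTime x (k + 1)) else 0 := by
  rw [tsum_eq_single (embedded x (k + 1))]
  · simp [discountedVisit, revPath_succ_eq_cons_iff]
  · intro b hb
    refine if_neg fun h => hb ?_
    rw [revPath_succ_eq_cons_iff] at h
    exact h.1.symm

open scoped Classical in
theorem discountQuotient_ite (c : ℝ≥0) (k : ℕ) (l : List S) :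
    (if revPath (embedded x) k = l then
      discountQuotient c (jumpTime x k) (jumpTime x (k + 1)) else 0) =
      (discountedVisit c x k l - (if revPath (embedded x) k = l then
        discount c (jumpTime x (k + 1)) else 0)) * (c : ℝ≥0∞)⁻¹ := by
  unfold discountedVisit discountQuotient
  split_ifs <;> simp [div_eq_mul_inv]

end PathSums

theorem Network.tsum_coe_rate {S : Type*} (γ : Network S) (a : S) :
    ∑' b, (γ.rate a b : ℝ≥0∞) = γ.exitRate a :=
  (ENNReal.coe_tsum (γ.summable_rate a)).symm

namespace IsMarkovChain

variable {S Ω : Type*} [MeasurableSpace Ω] {γ : Network S} {ℙ : S → Measure Ω}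
  {X : ℝ≥0 → Ω → S}

theorem lintegral_discountedVisit_ne_top (hX : IsMarkovChain γ ℙ X) (j : S) (c : ℝ≥0) (k : ℕ)
    (l : List S) : ∫⁻ ω, discountedVisit c (fun t => X t ω) k l ∂(ℙ j) ≠ ∞ := by
  have := hX.isProbabilityMeasure j
  refine ne_top_of_le_ne_top ENNReal.one_ne_top ?_
  calc _ ≤ ∫⁻ _, 1 ∂(ℙ j) := lintegral_mono fun ω => discountedVisit_le_one _ _ _ _
    _ = 1 := by simp

variable [Countable S]

theorem tendsto_lintegral_discountedVisit (hX : IsMarkovChain γ ℙ X) (j : S) {c : ℕ → ℝ≥0}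
    (hc : Tendsto c atTop (𝓝 0)) (k : ℕ) (l : List S) :
    Tendsto (fun n => ∫⁻ ω, discountedVisit (c n) (fun t => X t ω) k l ∂(ℙ j)) atTop
      (𝓝 (∫⁻ ω, discountedVisit 0 (fun t => X t ω) k l ∂(ℙ j))) := by
  have := hX.isProbabilityMeasure j
  refine tendsto_lintegral_of_dominated_convergence (fun _ => 1)
    (fun n => hX.measurable_discountedVisit _ k l)
    (fun n => Eventually.of_forall fun ω => discountedVisit_le_one _ _ _ _) (by simp)
    (Eventually.of_forall fun ω => ?_)
  unfold discountedVisit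
  split_ifs
  · exact tendsto_discount_zero hc _
  · exact tendsto_const_nhds

/-- The jump from `a` to `b` takes an exponential holding time of rate `γ.exitRate a` and goes to
`b` with probability `γ.rate a b / γ.exitRate a`, whatever the path was before: the Laplace
transform of this statement. -/
theorem lintegral_discountedVisit_succ' (hX : IsMarkovChain γ ℙ X) (j : S) (c : ℝ≥0) (k : ℕ)
    {a : S} (ha : 0 < γ.exitRate a) (b : S) (l : List S) :
    ∫⁻ ω, discountedVisit c (fun t => X t ω) (k + 1) (b :: a :: l) ∂(ℙ j) =
      (∫⁻ ω, discountedVisit c (fun t => X t ω) k (a :: l) ∂(ℙ j)) *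
        (γ.rate a b / (c + γ.exitRate a) : ℝ≥0) := by
  rcases eq_zero_or_pos c with rfl | hc
  swap
  · exact hX.lintegral_discountedVisit_succ j hc k a b l
  have h1 := hX.tendsto_lintegral_discountedVisit j tendsto_mesh (k + 1) (b :: a :: l)
  simp only [fun n => hX.lintegral_discountedVisit_succ j (mesh_pos n)] at h1
  refine tendsto_nhds_unique h1 (ENNReal.Tendsto.mul
    (hX.tendsto_lintegral_discountedVisit j tendsto_mesh k (a :: l))
    (Or.inr ENNReal.coe_ne_top) (ENNReal.tendsto_coe.2 ?_)
    (Or.inr (hX.lintegral_discountedVisit_ne_top _ _ _ _)))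
  exact tendsto_const_nhds.div (tendsto_mesh.add_const _) (by simpa using ha.ne')

open scoped Classical in
theorem measurable_discount_next (hX : IsMarkovChain γ ℙ X) (c : ℝ≥0) (k : ℕ) (l : List S) :
    Measurable fun ω => if revPath (embedded fun t => X t ω) k = l then
      discount c (jumpTime (fun t => X t ω) (k + 1)) else 0 := by
  simp only [← tsum_discountedVisit_succ]
  exact Measurable.tsum fun b => hX.measurable_discountedVisit _ _ _

open scoped Classical in
/-- The sum of `lintegral_discountedVisit_succ'` over the states `b` after the jump. -/
theorem lintegral_discount_next (hX : IsMarkovChain γ ℙ X) (j : S) (c : ℝ≥0) (k : ℕ)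
    {a : S} (ha : 0 < γ.exitRate a) (l : List S) :
    ∫⁻ ω, (if revPath (embedded fun t => X t ω) k = a :: l then
      discount c (jumpTime (fun t => X t ω) (k + 1)) else 0) ∂(ℙ j) =
      (∫⁻ ω, discountedVisit c (fun t => X t ω) k (a :: l) ∂(ℙ j)) *
        (γ.exitRate a / (c + γ.exitRate a) : ℝ≥0) := by
  simp only [← tsum_discountedVisit_succ]
  rw [lintegral_tsum fun b => (hX.measurable_discountedVisit _ _ _).aemeasurable]
  simp only [hX.lintegral_discountedVisit_succ' j c k ha]
  rw [ENNReal.tsum_mul_left]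
  simp only [div_eq_mul_inv, ENNReal.coe_mul]
  rw [ENNReal.tsum_mul_right, γ.tsum_coe_rate]

/-- Almost surely, the chain jumps infinitely often. -/
theorem ae_jumpTime_ne_top (hX : IsMarkovChain γ ℙ X) (hpos : ∀ a, 0 < γ.exitRate a) (j : S) :
    ∀ᵐ ω ∂(ℙ j), ∀ k, jumpTime (fun t => X t ω) k ≠ ∞ := by
  classical
  refine ae_all_iff.2 fun k => ?_
  induction k with
  | zero => simp [jumpTime]
  | succ k ih =>
    have key : ∀ᵐ ω ∂(ℙ j), ∀ l : List S, revPath (embedded fun t => X t ω) k = l →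
        jumpTime (fun t => X t ω) k ≠ ∞ → jumpTime (fun t => X t ω) (k + 1) ≠ ∞ := by
      refine ae_all_iff.2 fun l => ?_
      cases l with
      | nil =>
        refine Eventually.of_forall fun ω h => ?_
        simpa using congrArg List.length h
      | cons a l =>
        -- at discount rate `0`, the discount factors indicate that the jump times are finite
        have e := hX.lintegral_discount_next j 0 k (hpos a) l
        rw [zero_add, div_self (hpos a).ne', ENNReal.coe_one, mul_one] at e
        have h := ae_eq_of_ae_le_of_lintegral_le (μ := ℙ j)
          (f := fun ω => if revPath (embedded fun t => X t ω) k = a :: l then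
            discount 0 (jumpTime (fun t => X t ω) (k + 1)) else 0)
          (g := fun ω => discountedVisit 0 (fun t => X t ω) k (a :: l))
          (Eventually.of_forall fun ω => ?_) (e ▸ hX.lintegral_discountedVisit_ne_top _ _ _ _)
          (hX.measurable_discountedVisit _ _ _).aemeasurable e.ge
        · filter_upwards [h] with ω hω hl hk hk'
          rw [discountedVisit, if_pos hl, if_pos hl, hk', discount_top] at hω
          exact discount_ne_zero 0 hk hω.symm
        · unfold discountedVisit
          dsimp only
          split_ifs
          · exact discount_antitone 0 (jumpTime_mono _ (Nat.le_succ k))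
          · exact le_rfl
    filter_upwards [ih, key] with ω h1 h2 using h2 _ rfl h1

/-- Each jump contributes a factor of at most `C / (1 + C)`. -/
theorem lintegral_discount_jumpTime_le (hX : IsMarkovChain γ ℙ X)
    (hpos : ∀ a, 0 < γ.exitRate a) {C : ℝ≥0} (hC : ∀ a, γ.exitRate a ≤ C) (j : S) (k : ℕ) :
    ∫⁻ ω, discount 1 (jumpTime (fun t => X t ω) k) ∂(ℙ j) ≤ ((C / (1 + C) : ℝ≥0) : ℝ≥0∞) ^ k := by
  classical
  have := hX.isProbabilityMeasure j
  induction k with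
  | zero =>
    rw [pow_zero]
    calc _ ≤ ∫⁻ _, 1 ∂(ℙ j) := lintegral_mono fun ω => discount_le_one _ _
      _ = 1 := by simp
  | succ k ih =>
    have e (x : ℝ≥0 → S) : discount 1 (jumpTime x (k + 1)) = ∑' l : List S,
        if revPath (embedded x) k = l then discount 1 (jumpTime x (k + 1)) else 0 := by
      simp
    calc ∫⁻ ω, discount 1 (jumpTime (fun t => X t ω) (k + 1)) ∂(ℙ j)
        = ∑' l : List S, ∫⁻ ω, (if revPath (embedded fun t => X t ω) k = l then
            discount 1 (jumpTime (fun t => X t ω) (k + 1)) else 0) ∂(ℙ j) := by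
          rw [← lintegral_tsum fun l => (hX.measurable_discount_next 1 k l).aemeasurable]
          exact lintegral_congr fun ω => e _
      _ ≤ ∑' l : List S, (∫⁻ ω, discountedVisit 1 (fun t => X t ω) k l ∂(ℙ j)) *
            (C / (1 + C) : ℝ≥0) := by
          refine ENNReal.tsum_le_tsum fun l => ?_
          cases l with
          | nil =>
            have (ω : Ω) : revPath (embedded fun t => X t ω) k ≠ [] := fun h => by
              simpa using congrArg List.length h
            simp [this]
          | cons a l =>
            rw [hX.lintegral_discount_next j 1 k (hpos a) l]
            refine mul_le_mul_right (ENNReal.coe_le_coe.2 ?_) _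
            rw [div_le_div_iff₀ (by positivity) (by positivity), mul_add, mul_add, mul_one, mul_one,
              mul_comm C]
            exact add_le_add_left (hC a) _
      _ = (∫⁻ ω, discount 1 (jumpTime (fun t => X t ω) k) ∂(ℙ j)) * (C / (1 + C) : ℝ≥0) := by
          rw [ENNReal.tsum_mul_right,
            ← lintegral_tsum fun l => (hX.measurable_discountedVisit 1 k l).aemeasurable]
          simp only [tsum_discountedVisit]
      _ ≤ _ := by
          rw [pow_succ]
          exact mul_le_mul_left ih _

/-- Almost surely, the chain does not explode: the expected discount factor of the `k`-th jump time
decays geometrically, as the exit rates are bounded. -/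
theorem ae_iSup_jumpTime (hX : IsMarkovChain γ ℙ X) (hpos : ∀ a, 0 < γ.exitRate a) (j : S) :
    ∀ᵐ ω ∂(ℙ j), ⨆ k, jumpTime (fun t => X t ω) k = ∞ := by
  obtain ⟨C, hC⟩ := γ.exists_exitRate_le
  have hm (k : ℕ) : Measurable fun ω => discount 1 (jumpTime (fun t => X t ω) k) := by
    simp only [← tsum_discountedVisit]
    exact Measurable.tsum fun l => hX.measurable_discountedVisit 1 k l
  have h0 : ∫⁻ ω, ⨅ k, discount 1 (jumpTime (fun t => X t ω) k) ∂(ℙ j) = 0 := by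
    have hlt : ((C / (1 + C) : ℝ≥0) : ℝ≥0∞) < 1 := by
      rw [← ENNReal.coe_one, ENNReal.coe_lt_coe, div_lt_one (by positivity)]
      exact lt_add_of_pos_left C one_pos
    refine le_antisymm (ge_of_tendsto' (ENNReal.tendsto_pow_atTop_nhds_zero_of_lt_one hlt)
      fun k => ?_) zero_le
    exact (lintegral_mono fun ω => iInf_le _ k).trans
      (hX.lintegral_discount_jumpTime_le hpos hC j k)
  rw [lintegral_eq_zero_iff (Measurable.iInf hm)] at h0
  filter_upwards [h0] with ω hω
  by_contra hne
  have h1 := le_iInf fun k => discount_antitone 1 (le_iSup (jumpTime fun t => X t ω) k)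
  rw [show ⨅ k, discount 1 (jumpTime (fun t => X t ω) k) = 0 from hω] at h1
  exact discount_ne_zero 1 hne (nonpos_iff_eq_zero.1 h1)

open scoped Classical in
theorem ae_discountedVisit_zero (hX : IsMarkovChain γ ℙ X) (hpos : ∀ a, 0 < γ.exitRate a) (j : S)
    (k : ℕ) (l : List S) :
    (fun ω => if revPath (embedded fun t => X t ω) k = l then (1 : ℝ≥0∞) else 0) =ᵐ[ℙ j]
      fun ω => discountedVisit 0 (fun t => X t ω) k l := by
  filter_upwards [hX.ae_jumpTime_ne_top hpos j] with ω hω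
  simp only [discountedVisit, discount_zero (hω k)]

open scoped Classical in
theorem aemeasurable_revPath (hX : IsMarkovChain γ ℙ X) (hpos : ∀ a, 0 < γ.exitRate a) (j : S)
    (k : ℕ) (l : List S) :
    AEMeasurable (fun ω => if revPath (embedded fun t => X t ω) k = l then (1 : ℝ≥0∞) else 0)
      (ℙ j) :=
  (hX.measurable_discountedVisit 0 k l).aemeasurable.congr
    (hX.ae_discountedVisit_zero hpos j k l).symm

open scoped Classical in
/-- The embedded path is a Markov chain with transition probabilities
`γ.rate a b / γ.exitRate a`. -/
theorem lintegral_revPath_succ (hX : IsMarkovChain γ ℙ X) (hpos : ∀ a, 0 < γ.exitRate a) (j : S)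
    (k : ℕ) (a b : S) (l : List S) :
    ∫⁻ ω, (if revPath (embedded fun t => X t ω) (k + 1) = b :: a :: l then 1 else 0) ∂(ℙ j) =
      (∫⁻ ω, (if revPath (embedded fun t => X t ω) k = a :: l then 1 else 0) ∂(ℙ j)) *
        (γ.rate a b / γ.exitRate a : ℝ≥0) := by
  rw [lintegral_congr_ae (hX.ae_discountedVisit_zero hpos j _ _),
    lintegral_congr_ae (hX.ae_discountedVisit_zero hpos j _ _),
    hX.lintegral_discountedVisit_succ' j 0 k (hpos a), zero_add]

open scoped Classical in
theorem lintegral_discountQuotient (hX : IsMarkovChain γ ℙ X) (j : S) {c : ℝ≥0} (hc : 0 < c)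
    (k : ℕ) {a : S} (ha : 0 < γ.exitRate a) (l : List S) :
    ∫⁻ ω, (if revPath (embedded fun t => X t ω) k = a :: l then
      discountQuotient c (jumpTime (fun t => X t ω) k) (jumpTime (fun t => X t ω) (k + 1))
      else 0) ∂(ℙ j) =
      (∫⁻ ω, discountedVisit c (fun t => X t ω) k (a :: l) ∂(ℙ j)) *
        (1 / (c + γ.exitRate a) : ℝ≥0) := by
  set D := ∫⁻ ω, discountedVisit c (fun t => X t ω) k (a :: l) ∂(ℙ j) with hD
  have hDt : D ≠ ∞ := hX.lintegral_discountedVisit_ne_top _ _ _ _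
  have hn := hX.lintegral_discount_next j c k ha l
  rw [← hD] at hn
  simp only [discountQuotient_ite]
  rw [lintegral_mul_const' _ _ (ENNReal.inv_ne_top.2 (ENNReal.coe_ne_zero.2 hc.ne')),
    lintegral_sub (hX.measurable_discount_next _ _ _) (by rw [hn]; finiteness)
      (Eventually.of_forall fun ω => ?_), hn, ← hD]
  · have h1 : D = D * (γ.exitRate a / (c + γ.exitRate a) : ℝ≥0) +
        D * (c / (c + γ.exitRate a) : ℝ≥0) := by
      rw [← mul_add, ← ENNReal.coe_add, ← add_div, add_comm (γ.exitRate a),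
        div_self (add_pos hc ha).ne', ENNReal.coe_one, mul_one]
    have h2 : D - D * (γ.exitRate a / (c + γ.exitRate a) : ℝ≥0) =
        D * (c / (c + γ.exitRate a) : ℝ≥0) := by
      conv_lhs => enter [1]; rw [h1]
      exact ENNReal.add_sub_cancel_left (by finiteness)
    rw [h2, ← ENNReal.coe_inv hc.ne', mul_assoc, ← ENNReal.coe_mul]
    congr 2
    field_simp
  · unfold discountedVisit
    dsimp only
    split_ifs
    · exact discount_antitone c (jumpTime_mono _ (Nat.le_succ k))
    · exact le_rfl

end IsMarkovChain

section PathSums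

variable {S : Type*}

open scoped Classical in
/-- An event that concerns the states `[y k, …, y 0]`, split up according to these states. -/
theorem ite_mem_eq_tsum (y : ℕ → S) (k : ℕ) (p : List S → Prop) (a : S) (F : ℝ≥0∞) :
    (if p (revPath y k) ∧ y k = a then F else 0) =
      ∑' l, if p (a :: l) then (if revPath y k = a :: l then F else 0) else 0 := by
  by_cases h : p (revPath y k) ∧ y k = a
  · obtain ⟨h, rfl⟩ := h
    obtain ⟨l, hl⟩ : ∃ l, revPath y k = y k :: l := by
      cases k with
      | zero => exact ⟨[], rfl⟩
      | succ k => exact ⟨_, rfl⟩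
    rw [tsum_eq_single l]
    · rw [if_pos ⟨h, rfl⟩, if_pos (hl ▸ h), if_pos hl]
    · intro l' hl'
      have : revPath y k ≠ y k :: l' := fun hc => hl' (by simpa [hl] using hc.symm)
      simp [this]
  · rw [if_neg h]
    refine (ENNReal.tsum_eq_zero.2 fun l => ?_).symm
    split_ifs with h1 h2
    · exact absurd ⟨h2 ▸ h1, eq_of_revPath_eq_cons h2⟩ h
    · rfl
    · rfl

end PathSums

theorem tendsto_pow_half : Tendsto (fun n : ℕ => (1 / 2 : ℝ≥0) ^ n) atTop (𝓝 0) :=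
  NNReal.tendsto_pow_atTop_nhds_zero_of_lt_one (by
    rw [← NNReal.coe_lt_coe]; norm_num)

namespace IsMarkovChain

variable {S Ω : Type*} [MeasurableSpace Ω] {γ : Network S} {ℙ : S → Measure Ω}
  {X : ℝ≥0 → Ω → S} [Countable S]

open scoped Classical in
theorem measurable_discountQuotient (hX : IsMarkovChain γ ℙ X) (c : ℝ≥0) (k : ℕ) (l : List S) :
    Measurable fun ω => if revPath (embedded fun t => X t ω) k = l then
      discountQuotient c (jumpTime (fun t => X t ω) k) (jumpTime (fun t => X t ω) (k + 1))
      else 0 := by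
  simp only [discountQuotient_ite]
  exact ((hX.measurable_discountedVisit c k l).sub
    (hX.measurable_discount_next c k l)).mul_const _

open scoped Classical in
theorem ae_tendsto_discountQuotient (hX : IsMarkovChain γ ℙ X) (hpos : ∀ a, 0 < γ.exitRate a)
    (j : S) (k : ℕ) (l : List S) :
    ∀ᵐ ω ∂(ℙ j), Tendsto (fun n : ℕ => if revPath (embedded fun t => X t ω) k = l then
      discountQuotient ((1 / 2) ^ n) (jumpTime (fun t => X t ω) k)
        (jumpTime (fun t => X t ω) (k + 1)) else 0) atTop
      (𝓝 (if revPath (embedded fun t => X t ω) k = l then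
        jumpTime (fun t => X t ω) (k + 1) - jumpTime (fun t => X t ω) k else 0)) := by
  filter_upwards [hX.ae_jumpTime_ne_top hpos j] with ω hω
  split_ifs
  · exact tendsto_discountQuotient (fun n => by positivity) tendsto_pow_half (hω k) (hω (k + 1))
  · exact tendsto_const_nhds

open scoped Classical in
theorem aemeasurable_holdingTime (hX : IsMarkovChain γ ℙ X) (hpos : ∀ a, 0 < γ.exitRate a) (j : S)
    (k : ℕ) (l : List S) :
    AEMeasurable (fun ω => if revPath (embedded fun t => X t ω) k = l then
      jumpTime (fun t => X t ω) (k + 1) - jumpTime (fun t => X t ω) k else 0) (ℙ j) :=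
  aemeasurable_of_tendsto_metrizable_ae atTop
    (fun _ => (hX.measurable_discountQuotient _ k l).aemeasurable)
    (hX.ae_tendsto_discountQuotient hpos j k l)

open scoped Classical in
/-- The mean holding time in `a` is `1 / γ.exitRate a`, whatever the path was before. -/
theorem lintegral_holdingTime (hX : IsMarkovChain γ ℙ X) (hpos : ∀ a, 0 < γ.exitRate a) (j : S)
    (k : ℕ) (a : S) (l : List S) :
    ∫⁻ ω, (if revPath (embedded fun t => X t ω) k = a :: l then
      jumpTime (fun t => X t ω) (k + 1) - jumpTime (fun t => X t ω) k else 0) ∂(ℙ j) =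
      (∫⁻ ω, (if revPath (embedded fun t => X t ω) k = a :: l then 1 else 0) ∂(ℙ j)) *
        (1 / γ.exitRate a : ℝ≥0) := by
  have h := lintegral_tendsto_of_tendsto_of_monotone
    (fun n : ℕ => (hX.measurable_discountQuotient ((1 / 2) ^ n) k (a :: l)).aemeasurable) ?_
    (hX.ae_tendsto_discountQuotient hpos j k (a :: l))
  · simp only [fun n : ℕ => hX.lintegral_discountQuotient j (c := (1 / 2) ^ n) (by positivity) k
      (hpos a) l] at h
    rw [lintegral_congr_ae (hX.ae_discountedVisit_zero hpos j _ _)]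
    refine tendsto_nhds_unique h (ENNReal.Tendsto.mul
      (hX.tendsto_lintegral_discountedVisit j tendsto_pow_half k (a :: l))
      (Or.inr ENNReal.coe_ne_top) (ENNReal.tendsto_coe.2 ?_)
      (Or.inr (hX.lintegral_discountedVisit_ne_top _ _ _ _)))
    have := (tendsto_const_nhds (x := (1 : ℝ≥0))).div (tendsto_pow_half.add_const (γ.exitRate a))
      (by simpa using (hpos a).ne')
    rw [zero_add] at this
    exact this
  · filter_upwards [hX.ae_jumpTime_ne_top hpos j] with ω hω
    refine monotone_nat_of_le_succ fun n => ?_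
    split_ifs
    · have := discountQuotient_le_half (c := (1 / 2) ^ n) (by positivity)
        (jumpTime_mono (fun t => X t ω) (Nat.le_succ k)) (hω (k + 1))
      rwa [show ((1 / 2 : ℝ≥0) ^ n) / 2 = (1 / 2) ^ (n + 1) by rw [pow_succ]; ring] at this
    · exact le_rfl

open scoped Classical in
theorem aemeasurable_ite_mem (hX : IsMarkovChain γ ℙ X) (hpos : ∀ a, 0 < γ.exitRate a) (j : S)
    (k : ℕ) (p : List S → Prop) (a : S) :
    AEMeasurable (fun ω => if p (revPath (embedded fun t => X t ω) k) ∧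
      embedded (fun t => X t ω) k = a then (1 : ℝ≥0∞) else 0) (ℙ j) := by
  simp only [ite_mem_eq_tsum]
  refine AEMeasurable.tsum fun l => ?_
  split_ifs
  · exact hX.aemeasurable_revPath hpos j k (a :: l)
  · exact aemeasurable_const

open scoped Classical in
theorem aemeasurable_holdingTime_ite_mem (hX : IsMarkovChain γ ℙ X)
    (hpos : ∀ a, 0 < γ.exitRate a) (j : S) (k : ℕ) (p : List S → Prop) (a : S) :
    AEMeasurable (fun ω => if p (revPath (embedded fun t => X t ω) k) ∧
      embedded (fun t => X t ω) k = a then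
      jumpTime (fun t => X t ω) (k + 1) - jumpTime (fun t => X t ω) k else 0) (ℙ j) := by
  simp only [ite_mem_eq_tsum]
  refine AEMeasurable.tsum fun l => ?_
  split_ifs
  · exact hX.aemeasurable_holdingTime hpos j k (a :: l)
  · exact aemeasurable_const

open scoped Classical in
theorem lintegral_ite_mem (hX : IsMarkovChain γ ℙ X) (hpos : ∀ a, 0 < γ.exitRate a) (j : S)
    (k : ℕ) (p : List S → Prop) (a : S) :
    ∫⁻ ω, (if p (revPath (embedded fun t => X t ω) k) ∧
      embedded (fun t => X t ω) k = a then 1 else 0) ∂(ℙ j) =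
      ∑' l, if p (a :: l) then
        ∫⁻ ω, (if revPath (embedded fun t => X t ω) k = a :: l then 1 else 0) ∂(ℙ j) else 0 := by
  simp only [ite_mem_eq_tsum]
  rw [lintegral_tsum]
  · refine tsum_congr fun l => ?_
    split_ifs <;> simp
  · intro l
    split_ifs
    · exact hX.aemeasurable_revPath hpos j k (a :: l)
    · exact aemeasurable_const

open scoped Classical in
/-- The mean holding time in `a` after the `k`-th jump, on an event that is determined by the
states up to that jump. -/
theorem lintegral_holdingTime_ite_mem (hX : IsMarkovChain γ ℙ X) (hpos : ∀ a, 0 < γ.exitRate a)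
    (j : S) (k : ℕ) (p : List S → Prop) (a : S) :
    ∫⁻ ω, (if p (revPath (embedded fun t => X t ω) k) ∧ embedded (fun t => X t ω) k = a then
      jumpTime (fun t => X t ω) (k + 1) - jumpTime (fun t => X t ω) k else 0) ∂(ℙ j) =
      (∫⁻ ω, (if p (revPath (embedded fun t => X t ω) k) ∧
        embedded (fun t => X t ω) k = a then 1 else 0) ∂(ℙ j)) * (1 / γ.exitRate a : ℝ≥0) := by
  rw [hX.lintegral_ite_mem hpos, ← ENNReal.tsum_mul_right]
  simp only [ite_mem_eq_tsum _ _ _ _ (_ - _)]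
  rw [lintegral_tsum]
  · refine tsum_congr fun l => ?_
    split_ifs
    · exact hX.lintegral_holdingTime hpos j k a l
    · simp
  · intro l
    split_ifs
    · exact hX.aemeasurable_holdingTime hpos j k (a :: l)
    · exact aemeasurable_const

open scoped Classical in
/-- The Markov property of the embedded path, with an event that is determined by the past. -/
theorem lintegral_next_ite_mem (hX : IsMarkovChain γ ℙ X) (hpos : ∀ a, 0 < γ.exitRate a)
    (j : S) (k : ℕ) (p : List S → Prop) (a b : S) :
    ∫⁻ ω, (if (p (revPath (embedded fun t => X t ω) k) ∧ embedded (fun t => X t ω) k = a) ∧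
      embedded (fun t => X t ω) (k + 1) = b then 1 else 0) ∂(ℙ j) =
      (∫⁻ ω, (if p (revPath (embedded fun t => X t ω) k) ∧
        embedded (fun t => X t ω) k = a then 1 else 0) ∂(ℙ j)) *
        (γ.rate a b / γ.exitRate a : ℝ≥0) := by
  rw [hX.lintegral_ite_mem hpos, ← ENNReal.tsum_mul_right]
  have e (y : ℕ → S) : (if (p (revPath y k) ∧ y k = a) ∧ y (k + 1) = b then (1 : ℝ≥0∞) else 0) =
      ∑' l, if p (a :: l) then (if revPath y (k + 1) = b :: a :: l then 1 else 0) else 0 := by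
    simp only [revPath_succ_eq_cons_iff]
    by_cases hb : y (k + 1) = b
    · simp only [hb, and_true, true_and]
      exact ite_mem_eq_tsum y k p a 1
    · simp [hb]
  simp only [e]
  rw [lintegral_tsum]
  · refine tsum_congr fun l => ?_
    split_ifs
    · exact hX.lintegral_revPath_succ hpos j k a b l
    · simp
  · intro l
    split_ifs
    · exact hX.aemeasurable_revPath hpos j (k + 1) (b :: a :: l)
    · exact aemeasurable_const

end IsMarkovChain

/-! ### Visiting times and the return time -/

section Return

variable {S : Type*}

theorem lt_discreteReturnTime_iff {y : ℕ → S} {k : ℕ} :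
    (k : ℕ∞) < discreteReturnTime y ↔ ∀ m, 1 ≤ m → m ≤ k → y m ≠ y 0 := by
  constructor
  · intro h m h1 hk hm
    have : discreteReturnTime y ≤ m := iInf₂_le m ⟨h1, hm⟩
    exact absurd (h.trans_le this) (not_lt.2 (by exact_mod_cast hk))
  · intro h
    refine lt_of_lt_of_le (b := ((k + 1 : ℕ) : ℕ∞)) (by exact_mod_cast Nat.lt_succ_self k)
      (le_iInf₂ fun m hm => ?_)
    by_contra! hc
    exact h m hm.1 (Nat.lt_succ_iff.1 (by exact_mod_cast hc)) hm.2

theorem succ_lt_discreteReturnTime_iff {y : ℕ → S} {k : ℕ} :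
    ((k + 1 : ℕ) : ℕ∞) < discreteReturnTime y ↔
      (k : ℕ∞) < discreteReturnTime y ∧ y (k + 1) ≠ y 0 := by
  simp only [lt_discreteReturnTime_iff]
  constructor
  · exact fun h => ⟨fun m h1 h2 => h m h1 (h2.trans (Nat.le_succ k)),
      h _ (Nat.le_add_left 1 k) le_rfl⟩
  · rintro ⟨h, h'⟩ m h1 h2
    rcases Nat.le_succ_iff.1 h2 with h3 | rfl
    · exact h m h1 h3
    · exact h'

/-- The list is the reverse of a path that starts in `j` and has not returned to `j`. -/
def NoReturn (j : S) : List S → Prop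
  | [] => False
  | b :: l => (l = [] ∧ b = j) ∨ (b ≠ j ∧ NoReturn j l)

theorem noReturn_revPath_iff {y : ℕ → S} {j : S} (h0 : y 0 = j) (k : ℕ) :
    NoReturn j (revPath y k) ↔ (k : ℕ∞) < discreteReturnTime y := by
  induction k with
  | zero =>
    simp only [revPath, NoReturn, h0, lt_discreteReturnTime_iff]
    simp only [true_and, true_or, true_iff]
    omega
  | succ k ih =>
    have hne : revPath y k ≠ [] := fun h => by simpa using congrArg List.length h
    rw [revPath, NoReturn, succ_lt_discreteReturnTime_iff, ih, h0]
    simp [hne, and_comm]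

end Return

section PathIntegral

variable {S : Type*} {x : ℝ≥0 → S}

/-- While the path is in its `k`-th jump interval, it has returned to its initial state if and only
if the embedded path has. -/
theorem lt_returnTime_iff (hx : IsRightContinuous x) (hfin : ∀ k, jumpTime x k ≠ ∞)
    {k : ℕ} {t : ℝ≥0} (h1 : jumpTime x k ≤ t)
    (h2 : t < jumpTime x (k + 1)) :
    (t : ℝ≥0∞) < returnTime x ↔ (k : ℕ∞) < discreteReturnTime (embedded x) := by
  have hY0 : embedded x 0 = x 0 := by simp [embedded, jumpTime]
  have hJ (k : ℕ) : jumpTime x k < jumpTime x (k + 1) := jumpTime_lt_succ hx (hfin k)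
  rw [lt_discreteReturnTime_iff]
  constructor
  · rintro ht m hm1 hmk hm
    refine absurd (ht.trans_le (iInf₂_le (jumpTime x m).toNNReal ⟨hm.trans hY0, ?_⟩)) (not_lt.2 ?_)
    · rw [ENNReal.coe_toNNReal (hfin m)]
      exact (jumpTime_mono x hmk).trans h1
    · have hm2 : 2 ≤ m := by
        by_contra hc
        obtain rfl : m = 1 := by omega
        exact embedded_succ_ne hx (hfin 1) hm
      refine ⟨(jumpTime x 1).toNNReal, ?_, ?_, ?_⟩
      · exact ENNReal.toNNReal_pos (hJ 0).ne_bot (hfin 1)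
      · exact ENNReal.toNNReal_strict_mono (hfin m) ((hJ 1).trans_le (jumpTime_mono x hm2))
      · exact hY0 ▸ embedded_succ_ne hx (hfin 1)
  · intro h
    refine h2.trans_le (le_iInf₂ fun s hs => ?_)
    obtain ⟨hs0, τ, hτ0, hτs, hτ⟩ := hs
    by_contra! hc
    obtain ⟨m, hmk, h3, h4⟩ := exists_mem_jump_interval hc
    rw [eq_embedded h3 h4] at hs0
    rcases Nat.eq_zero_or_pos m with rfl | hm
    · refine hτ ((eq_embedded (k := 0) (by simp [jumpTime]) ?_).trans hY0)
      exact lt_trans (ENNReal.coe_lt_coe.2 hτs) h4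
    · exact h m hm (Nat.lt_succ_iff.1 hmk) (hs0.trans hY0.symm)

open scoped Classical in
/-- The integral of a function of the state up to the return time, as a sum over the jump
intervals. -/
theorem lintegral_returnTime (hx : IsRightContinuous x) (hfin : ∀ k, jumpTime x k ≠ ∞)
    (hsup : ⨆ k, jumpTime x k = ∞) (g : S → ℝ≥0∞) :
    ∫⁻ t : ℝ in {t : ℝ | 0 ≤ t ∧ ENNReal.ofReal t < returnTime x}, g (x t.toNNReal) =
      ∑' k : ℕ, if (k : ℕ∞) < discreteReturnTime (embedded x) then
        g (embedded x k) * (jumpTime x (k + 1) - jumpTime x k) else 0 := by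
  have hA : MeasurableSet {t : ℝ | 0 ≤ t ∧ ENNReal.ofReal t < returnTime x} :=
    measurableSet_Ici.inter (ENNReal.measurable_ofReal measurableSet_Iio)
  let I : ℕ → Set ℝ := fun k => Set.Ico (jumpTime x k).toReal (jumpTime x (k + 1)).toReal
  have hI (k : ℕ) (t : ℝ) (ht : 0 ≤ t) :
      t ∈ I k ↔ jumpTime x k ≤ t.toNNReal ∧ t.toNNReal < jumpTime x (k + 1) := by
    rw [Set.mem_Ico, ← ENNReal.le_ofReal_iff_toReal_le (hfin k) ht,
      ← ENNReal.ofReal_lt_iff_lt_toReal ht (hfin (k + 1))]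
    rfl
  have hvol (k : ℕ) : volume (I k) = jumpTime x (k + 1) - jumpTime x k := by
    rw [Real.volume_Ico, ENNReal.ofReal_sub _ ENNReal.toReal_nonneg, ENNReal.ofReal_toReal (hfin _),
      ENNReal.ofReal_toReal (hfin _)]
  have key (t : ℝ) : Set.indicator {t : ℝ | 0 ≤ t ∧ ENNReal.ofReal t < returnTime x}
      (fun t => g (x t.toNNReal)) t = ∑' k : ℕ, (I k).indicator (fun _ =>
        if (k : ℕ∞) < discreteReturnTime (embedded x) then g (embedded x k) else 0) t := by
    by_cases ht : 0 ≤ t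
    swap
    · rw [Set.indicator_of_notMem fun h => ht h.1]
      refine (ENNReal.tsum_eq_zero.2 fun k => Set.indicator_of_notMem (fun h => ht ?_) _).symm
      exact ENNReal.toReal_nonneg.trans h.1
    have hlt : (t.toNNReal : ℝ≥0∞) < ⨆ k, jumpTime x k := by rw [hsup]; exact ENNReal.coe_lt_top
    obtain ⟨K, hK⟩ := lt_iSup_iff.1 hlt
    obtain ⟨k, -, h1, h2⟩ := exists_mem_jump_interval hK
    rw [tsum_eq_single k]
    · rw [Set.indicator_of_mem ((hI k t ht).2 ⟨h1, h2⟩), ← eq_embedded h1 h2]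
      have := lt_returnTime_iff hx hfin h1 h2
      by_cases hr : (k : ℕ∞) < discreteReturnTime (embedded x)
      · rw [if_pos hr, Set.indicator_of_mem]
        exact ⟨ht, this.2 hr⟩
      · rw [if_neg hr, Set.indicator_of_notMem]
        exact fun h => hr (this.1 h.2)
    · intro m hm
      refine Set.indicator_of_notMem (fun h => hm ?_) _
      obtain ⟨h3, h4⟩ := (hI m t ht).1 h
      rcases lt_trichotomy m k with h | h | h
      · exact absurd (h4.trans_le (jumpTime_mono x h)) (not_lt.2 h1)
      · exact h
      · exact absurd (h2.trans_le (jumpTime_mono x h)) (not_lt.2 h3)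
  rw [← lintegral_indicator hA]
  simp only [key]
  rw [lintegral_tsum fun k => (measurable_const.indicator measurableSet_Ico).aemeasurable]
  refine tsum_congr fun k => ?_
  rw [lintegral_indicator_const measurableSet_Ico, hvol]
  split_ifs <;> simp

theorem volume_lt_returnTime (x : ℝ≥0 → S) :
    volume {t : ℝ | 0 ≤ t ∧ ENNReal.ofReal t < returnTime x} = returnTime x := by
  by_cases h : returnTime x = ∞
  · have : {t : ℝ | 0 ≤ t ∧ ENNReal.ofReal t < returnTime x} = Set.Ici 0 := by
      ext t; simp [h]
    rw [this, Real.volume_Ici, h]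
  · have : {t : ℝ | 0 ≤ t ∧ ENNReal.ofReal t < returnTime x} =
        Set.Ico 0 (returnTime x).toReal := by
      ext t
      simp only [Set.mem_ofPred_eq, Set.mem_Ico]
      refine and_congr_right fun ht => ?_
      rw [ENNReal.ofReal_lt_iff_lt_toReal ht h]
    rw [this, Real.volume_Ico, sub_zero, ENNReal.ofReal_toReal h]

open scoped Classical in
theorem returnTime_eq_tsum (hx : IsRightContinuous x) (hfin : ∀ k, jumpTime x k ≠ ∞)
    (hsup : ⨆ k, jumpTime x k = ∞) :
    returnTime x = ∑' k : ℕ, if (k : ℕ∞) < discreteReturnTime (embedded x) then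
        jumpTime x (k + 1) - jumpTime x k else 0 := by
  have h := lintegral_returnTime hx hfin hsup fun _ => 1
  rw [setLIntegral_one, volume_lt_returnTime] at h
  simpa only [one_mul] using h

end PathIntegral

open scoped Classical in
/-- The probability that the embedded chain that starts in `j` is in `i` at time `k` and has not
returned to `j` before or at time `k`. -/
noncomputable def visitProb {S Ω : Type*} [MeasurableSpace Ω] (ℙ : S → Measure Ω)
    (X : ℝ≥0 → Ω → S) (j : S) (k : ℕ) (i : S) : ℝ≥0∞ :=
  ∫⁻ ω, (if (k : ℕ∞) < discreteReturnTime (embedded fun t => X t ω) ∧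
    embedded (fun t => X t ω) k = i then 1 else 0) ∂(ℙ j)

namespace IsMarkovChain

variable {S Ω : Type*} [MeasurableSpace Ω] {γ : Network S} {ℙ : S → Measure Ω}
  {X : ℝ≥0 → Ω → S}

theorem ae_embedded_zero (hX : IsMarkovChain γ ℙ X) (j : S) :
    ∀ᵐ ω ∂(ℙ j), embedded (fun t => X t ω) 0 = j := by
  have := hX.isProbabilityMeasure j
  have h : ∀ᵐ ω ∂(ℙ j), X 0 ω = j :=
    (mem_ae_iff_prob_eq_one (hX.measurableSet 0 j)).2 (hX.start j)
  filter_upwards [h] with ω hω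
  simpa [embedded, jumpTime] using hω

open scoped Classical in
/-- Almost surely the path starts in `j`, and then its states up to the `k`-th jump determine whether
the embedded path has returned by then. -/
theorem ae_noReturn (hX : IsMarkovChain γ ℙ X) (j : S) (k : ℕ) (i : S) (F : Ω → ℝ≥0∞) :
    (fun ω => if NoReturn j (revPath (embedded fun t => X t ω) k) ∧
        embedded (fun t => X t ω) k = i then F ω else 0) =ᵐ[ℙ j]
      fun ω => if (k : ℕ∞) < discreteReturnTime (embedded fun t => X t ω) ∧
        embedded (fun t => X t ω) k = i then F ω else 0 := by
  filter_upwards [hX.ae_embedded_zero j] with ω hω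
  simp only [noReturn_revPath_iff hω]

open scoped Classical in
theorem visitProb_zero (hX : IsMarkovChain γ ℙ X) (j i : S) :
    visitProb ℙ X j 0 i = if i = j then 1 else 0 := by
  have := hX.isProbabilityMeasure j
  have h : visitProb ℙ X j 0 i = ∫⁻ _, (if i = j then 1 else 0) ∂(ℙ j) := by
    refine lintegral_congr_ae ?_
    filter_upwards [hX.ae_embedded_zero j] with ω hω
    have : ((0 : ℕ) : ℕ∞) < discreteReturnTime (embedded fun t => X t ω) :=
      lt_discreteReturnTime_iff.2 fun m h1 h2 => by omega
    simp only [this, hω, true_and, eq_comm]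
  rw [h]
  simp

variable [Countable S]

open scoped Classical in
/-- The embedded chain moves on by its transition probabilities, and is killed in `j`. -/
theorem visitProb_succ (hX : IsMarkovChain γ ℙ X) (hpos : ∀ a, 0 < γ.exitRate a) (j : S) (k : ℕ)
    (i : S) : visitProb ℙ X j (k + 1) i = if i = j then 0 else
      ∑' a, visitProb ℙ X j k a * (γ.rate a i / γ.exitRate a : ℝ≥0) := by
  have e : visitProb ℙ X j (k + 1) i = ∫⁻ ω, (∑' a, if i = j then 0 else
      if (NoReturn j (revPath (embedded fun t => X t ω) k) ∧ embedded (fun t => X t ω) k = a) ∧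
        embedded (fun t => X t ω) (k + 1) = i then 1 else 0) ∂(ℙ j) := by
    refine lintegral_congr_ae ?_
    filter_upwards [hX.ae_embedded_zero j] with ω hω
    rw [tsum_eq_single (embedded (fun t => X t ω) k) fun a ha => by simp [ha.symm]]
    simp only [succ_lt_discreteReturnTime_iff, noReturn_revPath_iff hω, hω]
    by_cases hi : embedded (fun t => X t ω) (k + 1) = i
    · by_cases hij : i = j <;> simp [hi, hij]
    · simp [hi]
  rw [e]
  by_cases hij : i = j
  · simp [hij]
  · simp only [if_neg hij]
    rw [lintegral_tsum]
    · refine tsum_congr fun a => ?_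
      rw [hX.lintegral_next_ite_mem hpos, visitProb]
      congr 1
      exact lintegral_congr_ae (hX.ae_noReturn j k a _)
    · intro a
      refine (hX.aemeasurable_ite_mem hpos j (k + 1)
        (fun l => NoReturn j l.tail ∧ l.tail.head? = some a) i).congr
        (Eventually.of_forall fun ω => ?_)
      simp only [revPath, List.tail_cons, head?_revPath, Option.some.injEq]

theorem visitingNumber_eq_tsum (hX : IsMarkovChain γ ℙ X) (hpos : ∀ a, 0 < γ.exitRate a)
    (j i : S) : visitingNumber ℙ X j i = ∑' k, visitProb ℙ X j k i := by
  classical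
  unfold visitingNumber visitProb
  rw [lintegral_tsum fun k => (hX.aemeasurable_ite_mem hpos j k (NoReturn j) i).congr
    (hX.ae_noReturn j k i _)]

open scoped Classical in
theorem aemeasurable_holdingTime_before_return (hX : IsMarkovChain γ ℙ X)
    (hpos : ∀ a, 0 < γ.exitRate a) (j : S) (k : ℕ) (i : S) :
    AEMeasurable (fun ω => if (k : ℕ∞) < discreteReturnTime (embedded fun t => X t ω) ∧
      embedded (fun t => X t ω) k = i then
      jumpTime (fun t => X t ω) (k + 1) - jumpTime (fun t => X t ω) k else 0) (ℙ j) :=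
  (hX.aemeasurable_holdingTime_ite_mem hpos j k (NoReturn j) i).congr (hX.ae_noReturn j k i _)

open scoped Classical in
theorem visitingTime_eq_tsum_lintegral (hX : IsMarkovChain γ ℙ X)
    (hpos : ∀ a, 0 < γ.exitRate a) (j i : S) : visitingTime ℙ X j i =
      ∑' k : ℕ, ∫⁻ ω, (if (k : ℕ∞) < discreteReturnTime (embedded fun t => X t ω) ∧
        embedded (fun t => X t ω) k = i then
        jumpTime (fun t => X t ω) (k + 1) - jumpTime (fun t => X t ω) k else 0) ∂(ℙ j) := by
  rw [← lintegral_tsum fun k => hX.aemeasurable_holdingTime_before_return hpos j k i]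
  refine lintegral_congr_ae ?_
  filter_upwards [hX.ae_jumpTime_ne_top hpos j, hX.ae_iSup_jumpTime hpos j] with ω h1 h2
  rw [lintegral_returnTime (hX.isRightContinuous ω) h1 h2 fun s => if s = i then 1 else 0]
  refine tsum_congr fun k => ?_
  split_ifs <;> simp_all

/-- Each visit to `i` lasts for the mean holding time `1 / γ.exitRate i`. -/
theorem visitingTime_eq_div (hX : IsMarkovChain γ ℙ X) (hpos : ∀ a, 0 < γ.exitRate a) (j i : S) :
    visitingTime ℙ X j i = visitingNumber ℙ X j i / (γ.exitRate i : ℝ≥0∞) := by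
  classical
  rw [hX.visitingTime_eq_tsum_lintegral hpos, hX.visitingNumber_eq_tsum hpos, div_eq_mul_inv,
    ← ENNReal.tsum_mul_right]
  refine tsum_congr fun k => ?_
  rw [← lintegral_congr_ae (hX.ae_noReturn j k i _), hX.lintegral_holdingTime_ite_mem hpos,
    lintegral_congr_ae (hX.ae_noReturn j k i _), visitProb, one_div,
    ENNReal.coe_inv (hpos i).ne']

theorem ae_returnTime_eq (hX : IsMarkovChain γ ℙ X) (hpos : ∀ a, 0 < γ.exitRate a) (j : S) :
    ∀ᵐ ω ∂(ℙ j), returnTime (fun t => X t ω) = ∑' i : S, ∑' k : ℕ, open scoped Classical in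
      if (k : ℕ∞) < discreteReturnTime (embedded fun t => X t ω) ∧
        embedded (fun t => X t ω) k = i then
        jumpTime (fun t => X t ω) (k + 1) - jumpTime (fun t => X t ω) k else 0 := by
  classical
  filter_upwards [hX.ae_jumpTime_ne_top hpos j, hX.ae_iSup_jumpTime hpos j] with ω h1 h2
  rw [returnTime_eq_tsum (hX.isRightContinuous ω) h1 h2, ENNReal.tsum_comm]
  refine tsum_congr fun k => ?_
  rw [tsum_eq_single (embedded (fun t => X t ω) k) fun a ha => by simp [ha.symm]]
  simp

theorem aemeasurable_returnTime (hX : IsMarkovChain γ ℙ X) (hpos : ∀ a, 0 < γ.exitRate a)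
    (j : S) : AEMeasurable (fun ω => returnTime fun t => X t ω) (ℙ j) := by
  classical
  refine AEMeasurable.congr ?_ (EventuallyEq.symm (hX.ae_returnTime_eq hpos j))
  exact AEMeasurable.tsum fun i => AEMeasurable.tsum fun k =>
    hX.aemeasurable_holdingTime_before_return hpos j k i

/-- The expected return time is the sum of the expected visiting times before the return. -/
theorem lintegral_returnTime_eq_norm (hX : IsMarkovChain γ ℙ X) (hpos : ∀ a, 0 < γ.exitRate a)
    (j : S) : ∫⁻ ω, returnTime (fun t => X t ω) ∂(ℙ j) = visitingTimeNorm ℙ X j := by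
  classical
  rw [lintegral_congr_ae (hX.ae_returnTime_eq hpos j), lintegral_tsum fun i =>
    AEMeasurable.tsum fun k => hX.aemeasurable_holdingTime_before_return hpos j k i]
  refine tsum_congr fun i => ?_
  rw [lintegral_tsum fun k => hX.aemeasurable_holdingTime_before_return hpos j k i,
    hX.visitingTime_eq_tsum_lintegral hpos]

/-- An integrable return time is almost surely finite, so positive recurrence is a condition on its
expectation alone. -/
theorem isPositiveRecurrent_iff (hX : IsMarkovChain γ ℙ X) (hpos : ∀ a, 0 < γ.exitRate a)
    (j : S) : IsPositiveRecurrent ℙ X j ↔ visitingTimeNorm ℙ X j ≠ ∞ := by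
  have := hX.isProbabilityMeasure j
  rw [IsPositiveRecurrent, hX.lintegral_returnTime_eq_norm hpos, lt_top_iff_ne_top]
  refine ⟨fun h => h.2, fun h => ⟨?_, h⟩⟩
  have h' := ae_lt_top' (hX.aemeasurable_returnTime hpos j)
    (by rwa [hX.lintegral_returnTime_eq_norm hpos])
  rw [← measure_univ (μ := ℙ j)]
  exact measure_congr (eventuallyEq_univ.2 h')

end IsMarkovChain

/-! ### Invariant measures and stationary solutions -/

namespace Network

variable {S : Type*} {γ : Network S}

theorem exitRate_pos [Nontrivial S] (hγ : γ.IsIrreducible) (a : S) : 0 < γ.exitRate a := by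
  obtain ⟨b, hb⟩ := exists_ne a
  rcases (hγ a b).cases_head with h | ⟨i, hi, -⟩
  · exact absurd h.symm hb
  · exact hi.trans_le ((γ.summable_rate a).le_tsum i fun _ _ => zero_le)

/-- The measure `μ` on the states is in balance: the flow into each state is the flow out of it. -/
def IsInvariant (γ : Network S) (μ : S → ℝ≥0∞) : Prop :=
  ∀ i, ∑' a, μ a * γ.rate a i = μ i * γ.exitRate i

/-- The zeros of an invariant measure propagate backwards along the transitions. -/
theorem IsInvariant.eq_zero (hγ : γ.IsIrreducible) {μ : S → ℝ≥0∞} (hμ : γ.IsInvariant μ) {j : S}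
    (hj : μ j = 0) (i : S) : μ i = 0 := by
  induction hγ i j using Relation.ReflTransGen.head_induction_on with
  | refl => exact hj
  | @head a b hab _ ih =>
    have h := hμ b
    rw [ih, zero_mul, ENNReal.tsum_eq_zero] at h
    exact (mul_eq_zero.1 (h a)).resolve_right (ENNReal.coe_ne_zero.2 hab.ne')

theorem generator_apply_eq {P : L1 S} (hP : ∀ i, 0 ≤ P i) (i : S) :
    γ.generator P i =
      (∑' a, ENNReal.ofReal (P a) * γ.rate a i).toReal -
        (ENNReal.ofReal (P i) * γ.exitRate i).toReal ∧
      ∑' a, ENNReal.ofReal (P a) * γ.rate a i ≠ ∞ := by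
  classical
  have hs2 : Summable fun a => (Pi.single i (γ.exitRate i * P i : ℝ) : S → ℝ) a :=
    (hasSum_pi_single i _).summable
  have e (a : S) : γ.entry i a * P a =
      P a * γ.rate a i - (Pi.single i (γ.exitRate i * P i : ℝ) : S → ℝ) a := by
    rw [entry]
    by_cases h : i = a
    · subst h; simp [γ.rate_self]
    · simp [h, mul_comm]
  have hs : Summable fun a => P a * (γ.rate a i : ℝ) := by
    refine ((γ.summable_row P i).add hs2).congr fun a => ?_
    rw [e]; ring
  have h0 (a : S) : 0 ≤ P a * (γ.rate a i : ℝ) := mul_nonneg (hP a) (NNReal.coe_nonneg _)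
  have h1 : ∑' a, ENNReal.ofReal (P a) * γ.rate a i =
      ENNReal.ofReal (∑' a, P a * (γ.rate a i : ℝ)) := by
    rw [ENNReal.ofReal_tsum_of_nonneg h0 hs]
    refine tsum_congr fun a => ?_
    rw [ENNReal.ofReal_mul (hP a), ENNReal.ofReal_coe_nnreal]
  refine ⟨?_, h1 ▸ ENNReal.ofReal_ne_top⟩
  rw [h1, ENNReal.toReal_ofReal (tsum_nonneg h0), generator_apply]
  simp only [e]
  rw [hs.tsum_sub hs2, tsum_pi_single, ENNReal.toReal_mul, ENNReal.toReal_ofReal (hP i)]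
  simp [mul_comm]

theorem isStationary_iff {P : L1 S} : γ.IsStationary P ↔
    (∀ i, 0 ≤ P i) ∧ ∑' i, ENNReal.ofReal (P i) = 1 ∧
      γ.IsInvariant fun i => ENNReal.ofReal (P i) := by
  refine and_congr_right fun hP => and_congr ?_ ?_
  · have hs : Summable fun i => P i := by
      simpa only [abs_of_nonneg (hP _)] using L1.summable_abs P
    rw [L1.norm_eq, ← ENNReal.ofReal_tsum_of_nonneg hP hs]
    simp only [abs_of_nonneg (hP _)]
    exact ENNReal.ofReal_eq_one.symm
  · have key (i : S) := generator_apply_eq (γ := γ) hP i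
    constructor
    · intro h i
      have h1 := (key i).1
      rw [h] at h1
      exact (ENNReal.toReal_eq_toReal_iff' (key i).2
        (ENNReal.mul_ne_top ENNReal.ofReal_ne_top ENNReal.coe_ne_top)).1 (sub_eq_zero.1 h1.symm)
    · intro h
      ext i
      rw [(key i).1, h i, sub_self]
      rfl

end Network

namespace IsMarkovChain

variable {S Ω : Type*} [MeasurableSpace Ω] {γ : Network S} {ℙ : S → Measure Ω}
  {X : ℝ≥0 → Ω → S} [Countable S]

theorem visitingNumber_eq_mul (hX : IsMarkovChain γ ℙ X) (hpos : ∀ a, 0 < γ.exitRate a) (j i : S) :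
    visitingNumber ℙ X j i = visitingTime ℙ X j i * γ.exitRate i := by
  rw [hX.visitingTime_eq_div hpos,
    ENNReal.div_mul_cancel (ENNReal.coe_ne_zero.2 (hpos i).ne') ENNReal.coe_ne_top]

open scoped Classical in
/-- The expected visiting times before the return to `j` balance in every state but `j`. -/
theorem visitingTime_mul_exitRate (hX : IsMarkovChain γ ℙ X) (hpos : ∀ a, 0 < γ.exitRate a)
    (j i : S) : visitingTime ℙ X j i * γ.exitRate i =
      if i = j then 1 else ∑' a, visitingTime ℙ X j a * γ.rate a i := by
  rw [← hX.visitingNumber_eq_mul hpos, hX.visitingNumber_eq_tsum hpos,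
    tsum_eq_zero_add' ENNReal.summable, hX.visitProb_zero]
  simp only [hX.visitProb_succ hpos]
  by_cases hij : i = j
  · simp [hij]
  · simp only [if_neg hij, zero_add]
    rw [ENNReal.tsum_comm]
    refine tsum_congr fun a => ?_
    rw [ENNReal.tsum_mul_right, ← hX.visitingNumber_eq_tsum hpos, hX.visitingTime_eq_div hpos,
      ENNReal.coe_div (hpos a).ne', div_eq_mul_inv, div_eq_mul_inv]
    ring

theorem visitingTime_self (hX : IsMarkovChain γ ℙ X) (hpos : ∀ a, 0 < γ.exitRate a) (j : S) :
    visitingTime ℙ X j j * γ.exitRate j = 1 := by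
  simp [hX.visitingTime_mul_exitRate hpos]

theorem visitingTimeNorm_ne_zero (hX : IsMarkovChain γ ℙ X) (hpos : ∀ a, 0 < γ.exitRate a)
    (j : S) : visitingTimeNorm ℙ X j ≠ 0 := by
  intro h
  have := hX.visitingTime_self hpos j
  rw [ENNReal.tsum_eq_zero.1 h j, zero_mul] at this
  exact zero_ne_one this

/-- If the expected return time is finite, the expected visiting times are invariant. The balance
in `j` follows from the other balances, as the total flows into and out of all states are equal and
finite. -/
theorem isInvariant_visitingTime (hX : IsMarkovChain γ ℙ X) (hpos : ∀ a, 0 < γ.exitRate a) {j : S}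
    (hj : visitingTimeNorm ℙ X j ≠ ∞) : γ.IsInvariant (visitingTime ℙ X j) := by
  classical
  obtain ⟨C, hC⟩ := γ.exists_exitRate_le
  set T := visitingTime ℙ X j
  have hT := hX.visitingTime_mul_exitRate hpos j
  have hfin : ∑' i, T i * γ.exitRate i ≠ ∞ := by
    refine ne_top_of_le_ne_top (ENNReal.mul_ne_top hj (ENNReal.coe_ne_top (r := C))) ?_
    rw [visitingTimeNorm, ← ENNReal.tsum_mul_right]
    exact ENNReal.tsum_le_tsum fun i => mul_le_mul_right (ENNReal.coe_le_coe.2 (hC i)) _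
  have hflow : ∑' i, ∑' a, T a * γ.rate a i = ∑' i, T i * γ.exitRate i := by
    rw [ENNReal.tsum_comm]
    simp only [ENNReal.tsum_mul_left, γ.tsum_coe_rate]
  have h1 := ENNReal.tsum_eq_add_tsum_ite (f := fun i => ∑' a, T a * γ.rate a i) j
  have h2 := ENNReal.tsum_eq_add_tsum_ite (f := fun i => T i * γ.exitRate i) j
  have h3 : (∑' i, if i = j then 0 else T i * γ.exitRate i) =
      ∑' i, if i = j then 0 else ∑' a, T a * γ.rate a i := by
    refine tsum_congr fun i => ?_
    rw [hT i]
    split_ifs <;> rfl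
  rw [h3] at h2
  have hne : (∑' i, if i = j then 0 else ∑' a, T a * γ.rate a i) ≠ ∞ :=
    ne_top_of_le_ne_top hfin (h2 ▸ le_add_self)
  intro i
  by_cases hij : i = j
  · subst hij
    exact (ENNReal.add_left_inj hne).1 (h1.symm.trans (hflow.trans h2))
  · rw [hT i, if_neg hij]

/-- The visiting times, scaled to the mass of an invariant measure in `j`, are bounded by that
measure. -/
theorem visitingTime_mul_le (hX : IsMarkovChain γ ℙ X) (hpos : ∀ a, 0 < γ.exitRate a)
    {μ : S → ℝ≥0∞} (hμ : γ.IsInvariant μ) (j i : S) :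
    visitingTime ℙ X j i * (μ j * γ.exitRate j) ≤ μ i := by
  classical
  -- the visits during the first `K` steps, by induction on `K`
  have hpart (K : ℕ) : ∀ i, (∑ k ∈ Finset.range K, visitProb ℙ X j k i) *
      (μ j * γ.exitRate j) ≤ μ i * γ.exitRate i := by
    induction K with
    | zero => simp
    | succ K ih =>
      intro i
      rw [Finset.sum_range_succ', hX.visitProb_zero]
      simp only [hX.visitProb_succ hpos]
      by_cases hij : i = j
      · simp [hij]
      · simp only [if_neg hij, add_zero]
        rw [← hμ i, ← Summable.tsum_finsetSum fun _ _ => ENNReal.summable,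
          ← ENNReal.tsum_mul_right]
        refine ENNReal.tsum_le_tsum fun a => ?_
        have ha : (γ.exitRate a : ℝ≥0∞) ≠ 0 := ENNReal.coe_ne_zero.2 (hpos a).ne'
        calc _ = ((∑ k ∈ Finset.range K, visitProb ℙ X j k a) * (μ j * γ.exitRate j)) *
              (γ.rate a i / γ.exitRate a : ℝ≥0) := by rw [← Finset.sum_mul]; ring
          _ ≤ μ a * γ.exitRate a * (γ.rate a i / γ.exitRate a : ℝ≥0) := mul_le_mul_left (ih a) _
          _ = μ a * γ.rate a i := by
              rw [mul_assoc, ← ENNReal.coe_mul, mul_div_cancel₀ _ (hpos a).ne']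
  have h : visitingNumber ℙ X j i * (μ j * γ.exitRate j) ≤ μ i * γ.exitRate i := by
    rw [hX.visitingNumber_eq_tsum hpos, ← ENNReal.tsum_mul_right]
    refine ENNReal.tsum_le_of_sum_range_le fun K => ?_
    rw [← Finset.sum_mul]
    exact hpart K i
  rw [hX.visitingNumber_eq_mul hpos, mul_right_comm] at h
  exact (ENNReal.mul_le_mul_iff_left (ENNReal.coe_ne_zero.2 (hpos i).ne') ENNReal.coe_ne_top).1 h

theorem visitingTimeNorm_ne_top (hX : IsMarkovChain γ ℙ X) (hpos : ∀ a, 0 < γ.exitRate a)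
    (hγ : γ.IsIrreducible) {μ : S → ℝ≥0∞} (hμ : γ.IsInvariant μ) (h1 : ∑' i, μ i = 1) (j : S) :
    visitingTimeNorm ℙ X j ≠ ∞ := by
  have hj : μ j * γ.exitRate j ≠ 0 := by
    refine mul_ne_zero (fun h => ?_) (ENNReal.coe_ne_zero.2 (hpos j).ne')
    simp [hμ.eq_zero hγ h] at h1
  have h : visitingTimeNorm ℙ X j * (μ j * γ.exitRate j) ≤ 1 := by
    rw [visitingTimeNorm, ← ENNReal.tsum_mul_right, ← h1]
    exact ENNReal.tsum_le_tsum fun i => hX.visitingTime_mul_le hpos hμ j i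
  intro htop
  rw [htop, ENNReal.top_mul hj] at h
  exact absurd h (by simp)

/-- An invariant probability measure is the normalized vector of visiting times: the difference of
the two is an invariant measure that vanishes in `j`. -/
theorem eq_visitingTime_div (hX : IsMarkovChain γ ℙ X) (hpos : ∀ a, 0 < γ.exitRate a)
    (hγ : γ.IsIrreducible) {μ : S → ℝ≥0∞} (hμ : γ.IsInvariant μ) (h1 : ∑' i, μ i = 1) (j i : S) :
    μ i = visitingTime ℙ X j i / visitingTimeNorm ℙ X j := by
  have hN := hX.visitingTimeNorm_ne_top hpos hγ hμ h1 j
  have hT := hX.isInvariant_visitingTime hpos hN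
  have hTtop (i : S) : visitingTime ℙ X j i ≠ ∞ := ENNReal.ne_top_of_tsum_ne_top hN i
  have hμtop (i : S) : μ i ≠ ∞ := ENNReal.ne_top_of_tsum_ne_top (h1 ▸ ENNReal.one_ne_top) i
  have hle := hX.visitingTime_mul_le hpos hμ j
  set c := μ j * γ.exitRate j with hc
  have hctop : c ≠ ∞ := ENNReal.mul_ne_top (hμtop j) ENNReal.coe_ne_top
  have hd : γ.IsInvariant fun i => μ i - visitingTime ℙ X j i * c := by
    intro i
    dsimp only
    refine (ENNReal.add_left_inj
      (ENNReal.mul_ne_top (ENNReal.mul_ne_top (hTtop i) hctop)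
        (ENNReal.coe_ne_top (r := γ.exitRate i)))).1 ?_
    rw [← add_mul, tsub_add_cancel_of_le (hle i), ← hμ i, mul_right_comm, ← hT i,
      ← ENNReal.tsum_mul_right, ← ENNReal.tsum_add]
    refine tsum_congr fun a => ?_
    rw [mul_right_comm _ _ c, ← add_mul, tsub_add_cancel_of_le (hle a)]
  have heq (i : S) : μ i = visitingTime ℙ X j i * c := by
    refine le_antisymm (tsub_eq_zero_iff_le.1 (hd.eq_zero hγ (j := j) ?_ i)) (hle i)
    rw [hc, mul_left_comm, hX.visitingTime_self hpos, mul_one, tsub_self]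
  have hcN : visitingTimeNorm ℙ X j * c = 1 := by
    rw [visitingTimeNorm, ← ENNReal.tsum_mul_right, ← h1]
    exact tsum_congr fun i => (heq i).symm
  rw [heq i, div_eq_mul_inv, ← ENNReal.eq_inv_of_mul_eq_one_left ((mul_comm c _).trans hcN)]

theorem isStationary_of_eq_visitingTime_div (hX : IsMarkovChain γ ℙ X)
    (hpos : ∀ a, 0 < γ.exitRate a) {j : S} (hj : visitingTimeNorm ℙ X j ≠ ∞) {P : L1 S}
    (hP : ∀ i, P i = (visitingTime ℙ X j i / visitingTimeNorm ℙ X j).toReal) :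
    γ.IsStationary P := by
  have h0 := hX.visitingTimeNorm_ne_zero hpos j
  have e (i : S) : ENNReal.ofReal (P i) = visitingTime ℙ X j i / visitingTimeNorm ℙ X j := by
    rw [hP, ENNReal.ofReal_toReal]
    exact ENNReal.div_ne_top (ENNReal.ne_top_of_tsum_ne_top hj i) h0
  refine Network.isStationary_iff.2 ⟨fun i => hP i ▸ ENNReal.toReal_nonneg, ?_, fun i => ?_⟩
  · simp only [e, div_eq_mul_inv]
    rw [ENNReal.tsum_mul_right]
    exact ENNReal.mul_inv_cancel h0 hj
  · simp only [e, div_eq_mul_inv]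
    rw [mul_right_comm, ← hX.isInvariant_visitingTime hpos hj i, ← ENNReal.tsum_mul_right]
    exact tsum_congr fun a => mul_right_comm _ _ _

theorem exists_isStationary (hX : IsMarkovChain γ ℙ X) (hpos : ∀ a, 0 < γ.exitRate a) {j : S}
    (hj : visitingTimeNorm ℙ X j ≠ ∞) : ∃ P, γ.IsStationary P := by
  have h0 := hX.visitingTimeNorm_ne_zero hpos j
  have hs : Summable fun i => (visitingTime ℙ X j i / visitingTimeNorm ℙ X j).toReal := by
    refine ENNReal.summable_toReal ?_
    simp only [div_eq_mul_inv]
    rw [ENNReal.tsum_mul_right]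
    exact ENNReal.mul_ne_top hj (ENNReal.inv_ne_top.2 h0)
  refine ⟨⟨fun i => (visitingTime ℙ X j i / visitingTimeNorm ℙ X j).toReal,
    memℓp_gen (by simpa using hs)⟩, ?_⟩
  exact hX.isStationary_of_eq_visitingTime_div hpos hj fun i => rfl

end IsMarkovChain

end CTMC

theorem mainTheorem10 {S Ω : Type*} [Countable S] [Nontrivial S] [MeasurableSpace Ω]
    (γ : CTMC.Network S) (hγ : γ.IsIrreducible)
    (ℙ : S → Measure Ω) (X : ℝ≥0 → Ω → S) (hX : CTMC.IsMarkovChain γ ℙ X) :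
    -- the three conditions are equivalent
    List.TFAE [
      ∀ j, CTMC.IsPositiveRecurrent ℙ X j,
      ∃ j, CTMC.IsPositiveRecurrent ℙ X j,
      ∃ P, γ.IsStationary P] ∧
    -- if they hold, the stationary solution is `T / ‖T‖₁`, whatever the reference state `j` is
    ((∃ P, γ.IsStationary P) → ∀ j,
      CTMC.visitingTimeNorm ℙ X j ≠ 0 ∧ CTMC.visitingTimeNorm ℙ X j ≠ ∞ ∧
      ∀ P : CTMC.L1 S, γ.IsStationary P ↔
        ∀ i, P i = (CTMC.visitingTime ℙ X j i / CTMC.visitingTimeNorm ℙ X j).toReal) ∧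
    -- `T_i = N_i / γ_{i →}`
    (∀ j i, CTMC.visitingTime ℙ X j i = CTMC.visitingNumber ℙ X j i / (γ.exitRate i : ℝ≥0∞)) := by
  have hpos := CTMC.Network.exitRate_pos hγ
  have hnorm : (∃ P, γ.IsStationary P) → ∀ j, CTMC.visitingTimeNorm ℙ X j ≠ ∞ := by
    rintro ⟨P, hP⟩ j
    obtain ⟨-, h1, hinv⟩ := CTMC.Network.isStationary_iff.1 hP
    exact hX.visitingTimeNorm_ne_top hpos hγ hinv h1 j
  refine ⟨?_, fun hex j => ⟨hX.visitingTimeNorm_ne_zero hpos j, hnorm hex j, fun P => ⟨?_, ?_⟩⟩,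
    hX.visitingTime_eq_div hpos⟩
  · tfae_have 1 → 2 := fun h => (exists_pair_ne S).imp fun j _ => h j
    tfae_have 2 → 3 := fun ⟨j, hj⟩ =>
      hX.exists_isStationary hpos ((hX.isPositiveRecurrent_iff hpos j).1 hj)
    tfae_have 3 → 1 := fun h j => (hX.isPositiveRecurrent_iff hpos j).2 (hnorm h j)
    tfae_finish
  · intro hP i
    obtain ⟨h0, h1, hinv⟩ := CTMC.Network.isStationary_iff.1 hP
    rw [← hX.eq_visitingTime_div hpos hγ hinv h1 j i, ENNReal.toReal_ofReal (h0 i)]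
  · exact hX.isStationary_of_eq_visitingTime_div hpos (hnorm hex j)
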